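/- Let $G$ be a compact metric tree, i.e. a connected metric graph without cycles, made of finitely many (at least one) edges $e$, each a compact interval $[0,|e|]$ of length $|e|>0$, glued together at vertices. For a bounded measurable potential $q:G\to\mathbb R$ let $H_q u=-u''+qu$ be the Schrödinger operator in $L^2(G)$ with standard vertex conditions (functions in its domain are continuous on $G$, belong to $W^{2,2}$ on every edge, and at every vertex the sum of the derivatives along the incident edges, taken in the direction into the vertex, is zero). Let $\lambda_1(G,q)<\lambda_2(G,q)\le\dots$ be its eigenvalues, repeated according to multiplicity, and let $\Gamma[q]=\lambda_2(G,q)-\lambda_1(G,q)$ be the fundamental gap. For $M>0$ let $C_{G,M}$ be the set of all functions $q:G\to\mathbb R$ with $0\le q\le M$ that are convex on every path from one leaf (vertex of degree one) of $G$ to another leaf, the path being regarded as an interval parametrized by arc length. If the eigenvalue $\lambda_2(G,0)$ of the Laplacian ($q=0$) has multiplicity at least two, then for every $M>0$ the potential $q=0$ does not minimize $\Gamma[q]$ among $q\in C_{G,M}$. -/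

import Mathlib

open MeasureTheory

noncomputable section

/-- A compact metric graph: finitely many edges `e`, each identified with the interval
`[0, len e]`, whose ends are partitioned into vertices. The end `(e, false)` is the point `0` of
`e`, the end `(e, true)` is the point `len e`, and `vert a` is the class (vertex) of the end `a`.
Loops and parallel edges are allowed. -/
structure MetricGraph (V E : Type*) where
  len : E → ℝ
  len_pos : ∀ e, 0 < len e
  vert : E × Bool → V
  vert_surjective : Function.Surjective vert

namespace MetricGraph

variable {V E : Type*} (G : MetricGraph V E)

lemma len_nonneg (e : E) : 0 ≤ G.len e := (G.len_pos e).le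

/-- The disjoint union of the edges. -/
abbrev PrePoint : Type _ := Σ e : E, Set.Icc (0 : ℝ) (G.len e)

/-- An end of an edge as a point of that edge. -/
def preEnd (a : E × Bool) : G.PrePoint :=
  match a with
  | (e, false) => ⟨e, ⟨0, le_rfl, G.len_nonneg e⟩⟩
  | (e, true) => ⟨e, ⟨G.len e, G.len_nonneg e, le_rfl⟩⟩

lemma preEnd_injective : Function.Injective G.preEnd := by
  rintro ⟨e, b⟩ ⟨e', b'⟩ h
  have he : e = e' := by
    have := congrArg Sigma.fst h
    cases b <;> cases b' <;> exact this
  subst he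
  have hl := G.len_pos e
  cases b <;> cases b' <;> simp only [preEnd, Sigma.mk.injEq, heq_eq_eq, true_and] at h
  · rfl
  · exact absurd (congrArg Subtype.val h) hl.ne
  · exact absurd (congrArg Subtype.val h) hl.ne'
  · rfl

/-- Two points of the disjoint union are glued when they are equal, or when they are ends of edges
that belong to the same vertex. -/
def gluing : Setoid G.PrePoint where
  r p p' := p = p' ∨ ∃ a b, p = G.preEnd a ∧ p' = G.preEnd b ∧ G.vert a = G.vert b
  iseqv :=
    { refl := fun _ => Or.inl rfl
      symm := by
        rintro p p' (h | ⟨a, b, h1, h2, h3⟩)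
        · exact Or.inl h.symm
        · exact Or.inr ⟨b, a, h2, h1, h3.symm⟩
      trans := by
        rintro p p' p'' (h | ⟨a, b, h1, h2, h3⟩) (k | ⟨c, d, k1, k2, k3⟩)
        · exact Or.inl (h.trans k)
        · exact Or.inr ⟨c, d, h.trans k1, k2, k3⟩
        · exact Or.inr ⟨a, b, h1, k.symm.trans h2, h3⟩
        · have hbc : b = c := G.preEnd_injective (h2.symm.trans k1)
          exact Or.inr ⟨a, d, h1, k2, h3.trans (hbc ▸ k3)⟩ }

/-- The points of the metric graph, with the quotient topology (which, the graph being finite, is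
the topology of the path metric). -/
def Point : Type _ := Quotient G.gluing

instance : TopologicalSpace G.Point := inferInstanceAs (TopologicalSpace (Quotient G.gluing))

/-- The point of `G` with coordinate `x` on the edge `e`. -/
def pt (e : E) (x : Set.Icc (0 : ℝ) (G.len e)) : G.Point := Quotient.mk G.gluing ⟨e, x⟩

/-- The point of `G` represented by the end `a` of an edge, that is, the vertex `G.vert a`. -/
def endPt (a : E × Bool) : G.Point := Quotient.mk G.gluing (G.preEnd a)

/-- The restriction `u_e` of a function `u` on `G` to the edge `e`, as a function on `[0, len e]`
(continued by its end values to the real line; only its values on `[0, len e]` are used). -/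
def onEdge (u : G.Point → ℝ) (e : E) : ℝ → ℝ :=
  Set.IccExtend (G.len_nonneg e) (fun x => u (G.pt e x))

/-! ### Trees and leaves -/

/-- The unordered pair of vertices joined by an edge. -/
def edgeEnds (e : E) : Sym2 V := s(G.vert (e, false), G.vert (e, true))

/-- `G` is a tree: it is connected and has no cycles. Loops are cycles with one edge, parallel
edges are cycles with two edges; when there are none of these, `G` has the same connectedness and
the same cycles as the simple graph of its adjacencies. -/
structure IsTree : Prop where
  loopless : ∀ e, G.vert (e, false) ≠ G.vert (e, true)
  no_parallel : Function.Injective G.edgeEnds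
  isTree : (SimpleGraph.fromEdgeSet (Set.range G.edgeEnds)).IsTree

/-- The degree of a vertex: the number of ends of edges in it. -/
def degree [Fintype E] [DecidableEq V] (v : V) : ℕ :=
  (Finset.univ.filter (fun a : E × Bool => G.vert a = v)).card

def IsLeaf [Fintype E] [DecidableEq V] (v : V) : Prop := G.degree v = 1

/-! ### The Schrödinger operator with standard (continuity and Kirchhoff) vertex conditions -/

/-- `f` belongs to `W^{1,2}(0, l)`, with weak derivative `g`; here `f` stands for its continuous
representative on `[0, l]`. -/
def HasSobolevDeriv (l : ℝ) (f g : ℝ → ℝ) : Prop :=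
  MemLp g 2 (volume.restrict (Set.Icc 0 l)) ∧
    ∀ x ∈ Set.Icc 0 l, f x = f 0 + ∫ y in (0 : ℝ)..x, g y

/-- The normal derivative, pointing into the vertex, at the end `a` of an edge, for a function on
`G` with edgewise derivatives `d`. -/
def normalDeriv (d : E → ℝ → ℝ) (a : E × Bool) : ℝ :=
  match a with
  | (e, false) => -d e 0
  | (e, true) => d e (G.len e)

/-- `u` is in the domain of the Schrödinger operator `H = -d²/dx² + q` on `G` and `H u = f`:
`u` is continuous on `G`, it is in `W^{2,2}` on each edge, with first and second derivatives `d e`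
and `dd e`, at each vertex the normal derivatives sum up to zero, and `-u'' + q u = f` almost
everywhere. -/
def SchrodingerEq [Fintype E] [DecidableEq V] (q u f : G.Point → ℝ) : Prop :=
  Continuous u ∧ ∃ d dd : E → ℝ → ℝ,
    (∀ e, HasSobolevDeriv (G.len e) (G.onEdge u e) (d e)) ∧
    (∀ e, HasSobolevDeriv (G.len e) (d e) (dd e)) ∧
    (∀ v, ∑ a : E × Bool with G.vert a = v, G.normalDeriv d a = 0) ∧
    (∀ e, ∀ᵐ x ∂volume.restrict (Set.Icc 0 (G.len e)),
      -dd e x + G.onEdge q e x * G.onEdge u e x = G.onEdge f e x)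

lemma onEdge_add (u v : G.Point → ℝ) (e : E) (x : ℝ) :
    G.onEdge (u + v) e x = G.onEdge u e x + G.onEdge v e x := rfl

lemma onEdge_smul (c : ℝ) (u : G.Point → ℝ) (e : E) (x : ℝ) :
    G.onEdge (c • u) e x = c * G.onEdge u e x := rfl

lemma HasSobolevDeriv.intervalIntegrable {l : ℝ} {f g : ℝ → ℝ} (h : HasSobolevDeriv l f g)
    {x : ℝ} (hx : x ∈ Set.Icc 0 l) : IntervalIntegrable g volume 0 x := by
  have h1 : IntegrableOn g (Set.Icc 0 l) volume := h.1.integrable (by norm_num)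
  rw [intervalIntegrable_iff_integrableOn_Icc_of_le hx.1]
  exact h1.mono_set (Set.Icc_subset_Icc_right hx.2)

lemma HasSobolevDeriv.add {l : ℝ} {f g f' g' : ℝ → ℝ} (h : HasSobolevDeriv l f g)
    (h' : HasSobolevDeriv l f' g') :
    HasSobolevDeriv l (fun x => f x + f' x) (fun x => g x + g' x) := by
  refine ⟨h.1.add h'.1, fun x hx => ?_⟩
  beta_reduce
  rw [intervalIntegral.integral_add (h.intervalIntegrable hx) (h'.intervalIntegrable hx),
    h.2 x hx, h'.2 x hx]
  ring

lemma HasSobolevDeriv.const_mul {l : ℝ} {f g : ℝ → ℝ} (c : ℝ) (h : HasSobolevDeriv l f g) :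
    HasSobolevDeriv l (fun x => c * f x) (fun x => c * g x) := by
  refine ⟨h.1.const_mul c, fun x hx => ?_⟩
  beta_reduce
  rw [intervalIntegral.integral_const_mul, h.2 x hx]
  ring

/-- The eigenspace `{u ∈ dom H : H u = mu u}`; it is zero unless `mu` is an eigenvalue. -/
def eigenspace [Fintype E] [DecidableEq V] (q : G.Point → ℝ) (mu : ℝ) :
    Submodule ℝ (G.Point → ℝ) where
  carrier := {u | G.SchrodingerEq q u (mu • u)}
  zero_mem' := by
    refine ⟨continuous_const, fun _ _ => 0, fun _ _ => 0, fun e => ⟨?_, ?_⟩, fun e => ⟨?_, ?_⟩,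
      fun v => ?_, fun e => ?_⟩
    · exact MemLp.zero
    · intro x _; simp [onEdge, Set.IccExtend]
    · exact MemLp.zero
    · intro x _; simp
    · refine Finset.sum_eq_zero ?_
      rintro ⟨e, b⟩ _
      cases b <;> simp [normalDeriv]
    · exact Filter.Eventually.of_forall fun x => by simp [onEdge, Set.IccExtend]
  add_mem' := by
    rintro u u' ⟨hc, d, dd, h1, h2, h3, h4⟩ ⟨hc', d', dd', h1', h2', h3', h4'⟩
    refine ⟨hc.add hc', fun e x => d e x + d' e x, fun e x => dd e x + dd' e x,
      fun e => (h1 e).add (h1' e), fun e => (h2 e).add (h2' e), fun v => ?_, fun e => ?_⟩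
    · have h := congrArg₂ (· + ·) (h3 v) (h3' v)
      simp only [add_zero] at h
      rw [← h, ← Finset.sum_add_distrib]
      refine Finset.sum_congr rfl ?_
      rintro ⟨e, b⟩ _
      cases b <;> simp [normalDeriv]
      ring
    · filter_upwards [h4 e, h4' e] with x hx hx'
      simp only [onEdge_add, onEdge_smul] at hx hx' ⊢
      linarith
  smul_mem' := by
    rintro c u ⟨hc, d, dd, h1, h2, h3, h4⟩
    refine ⟨hc.const_smul c, fun e x => c * d e x, fun e x => c * dd e x,
      fun e => (h1 e).const_mul c, fun e => (h2 e).const_mul c, fun v => ?_, fun e => ?_⟩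
    · rw [← mul_zero c, ← h3 v, Finset.mul_sum]
      refine Finset.sum_congr rfl ?_
      rintro ⟨e, b⟩ _
      cases b <;> simp [normalDeriv]
    · filter_upwards [h4 e] with x hx
      simp only [onEdge_smul] at hx ⊢
      linear_combination c * hx

/-- The multiplicity of `mu` as an eigenvalue: the dimension of its eigenspace. -/
def multiplicity [Fintype E] [DecidableEq V] (q : G.Point → ℝ) (mu : ℝ) : Cardinal :=
  Module.rank ℝ (G.eigenspace q mu)

/-- The eigenvalues `λ₁ ≤ λ₂ ≤ …` of `H` in increasing order, repeated according to multiplicity: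
`λ_n` (`n ≥ 1`) is the smallest real number such that the eigenfunctions with eigenvalue at most
that number span a space of dimension at least `n`. -/
def eigenvalue [Fintype E] [DecidableEq V] (q : G.Point → ℝ) (n : ℕ) : ℝ :=
  sInf {r : ℝ | (n : Cardinal) ≤
    Module.rank ℝ (⨆ mu : Set.Iic r, G.eigenspace q mu : Submodule ℝ (G.Point → ℝ))}

/-- The fundamental gap `Γ[q] = λ₂(G, q) - λ₁(G, q)`. -/
def fundamentalGap [Fintype E] [DecidableEq V] (q : G.Point → ℝ) : ℝ :=
  G.eigenvalue q 2 - G.eigenvalue q 1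

/-! ### Paths and convex potentials -/

/-- A (non-closed) path in `G`, given by its parametrization by arc length `toFun` on
`[0, length]`, which identifies the path with an interval. Parametrization by arc length means:
on each time interval `[s, t]` during which the path stays in one edge `e`, with (continuous)
coordinate `x`, the distance travelled is `t - s`. -/
structure ArcPath where
  length : ℝ
  toFun : ℝ → G.Point
  length_pos : 0 < length
  continuousOn : ContinuousOn toFun (Set.Icc 0 length)
  injOn : Set.InjOn toFun (Set.Icc 0 length)
  unit_speed : ∀ s t : ℝ, 0 ≤ s → s ≤ t → t ≤ length →
    ∀ (e : E) (x : ℝ → Set.Icc (0 : ℝ) (G.len e)), ContinuousOn x (Set.Icc s t) →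
      (∀ r ∈ Set.Icc s t, toFun r = G.pt e (x r)) → |(x t : ℝ) - (x s : ℝ)| = t - s

/-- The paths from one leaf to another leaf. -/
def leafPaths [Fintype E] [DecidableEq V] : Set G.ArcPath :=
  {P | ∃ a b : E × Bool, G.IsLeaf (G.vert a) ∧ G.IsLeaf (G.vert b) ∧ G.vert a ≠ G.vert b ∧
    P.toFun 0 = G.endPt a ∧ P.toFun P.length = G.endPt b}

/-- The class of functions that are convex on each of the given paths, regarded as an interval,
and take their values in `[0, M]` on the union of these paths. -/
def pathwiseConvexClass (Ps : Set G.ArcPath) (M : ℝ) : Set (G.Point → ℝ) :=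
  {q | (∀ P ∈ Ps, ConvexOn ℝ (Set.Icc 0 P.length) (fun s => q (P.toFun s))) ∧
    ∀ P ∈ Ps, ∀ s ∈ Set.Icc 0 P.length, 0 ≤ q (P.toFun s) ∧ q (P.toFun s) ≤ M}

/-- The class `C_{G,M}` of convex potentials on a tree, bounded by `M`. -/
def convexClass [Fintype E] [DecidableEq V] (M : ℝ) : Set (G.Point → ℝ) :=
  G.pathwiseConvexClass G.leafPaths M

end MetricGraph

end

noncomputable section

namespace MetricGraph

variable {V E : Type*} (G : MetricGraph V E)

/-! ### Functions on a metric graph, edge by edge -/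

/-! The gap is lowered by a potential supported on the edge of one leaf. As the eigenspace of λ₂(G,
0) has dimension at least two, it contains some u ≠ 0 that vanishes at a leaf b
(`exists_eigenfunction_eq_zero`). The Kirchhoff condition at a leaf is a Neumann condition, so u has
zero Cauchy data there and vanishes on the whole edge of b (`onEdge_eq_zero_of_leaf`). A potential q
supported on that edge therefore keeps u as an eigenfunction with the same eigenvalue
(`mem_eigenspace_of_support`). If λ₁(G, q) > 0 = λ₁(G, 0) while u is independent of the ground
state, then λ₂(G, q) ≤ λ₂(G, 0) and the gap strictly decreases.

It remains to find such a q in the convex class (`exists_potential`). Instead of a variational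
argument, a positive eigenfunction with eigenvalue k² > 0 is built first and q is read off from it.
Off the edge of b it solves -f'' = k²f, with value 1 at the vertex v₀ opposite to b and the
Kirchhoff condition at the other vertices; for small k this is a perturbation of an invertible
linear system whose solution at k = 0 is the constant 1 (`exists_vertexValues`). Its total outward
derivative c at v₀ is nonnegative and small. On the edge of b the function is the exponential of an
explicit polynomial, with derivative -c at v₀ and 0 at b; its Riccati expression is a small,
increasing, convex potential starting from 0 (`LeafProfile`). Such a function of the distance from
v₀ is convex on all paths between leaves, since along each of them this distance vanishes or is a
ramp (`comp_leafDist_mem_convexClass`). Finally, a Jacobi-type identity shows that a positive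
eigenfunction belongs to the lowest eigenvalue (`eq_zero_of_lt_of_pos`). -/

/-- The coordinate of an end on its edge. -/
def endCoord (a : E × Bool) : ℝ := if a.2 then G.len a.1 else 0

lemma endCoord_mem (a : E × Bool) : G.endCoord a ∈ Set.Icc 0 (G.len a.1) := by
  have := G.len_nonneg a.1
  unfold endCoord
  split_ifs <;> simp [this]

lemma preEnd_eq (a : E × Bool) : G.preEnd a = ⟨a.1, ⟨G.endCoord a, G.endCoord_mem a⟩⟩ := by
  obtain ⟨e, b⟩ := a
  cases b <;> rfl

lemma endPt_eq_pt (a : E × Bool) : G.endPt a = G.pt a.1 ⟨G.endCoord a, G.endCoord_mem a⟩ := by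
  rw [endPt, preEnd_eq, pt]

lemma endPt_congr {a b : E × Bool} (h : G.vert a = G.vert b) : G.endPt a = G.endPt b :=
  Quotient.sound (Or.inr ⟨a, b, rfl, rfl, h⟩)

lemma onEdge_of_mem (u : G.Point → ℝ) (e : E) {x : ℝ} (hx : x ∈ Set.Icc 0 (G.len e)) :
    G.onEdge u e x = u (G.pt e ⟨x, hx⟩) :=
  Set.IccExtend_of_mem _ _ hx

lemma onEdge_endCoord (u : G.Point → ℝ) (a : E × Bool) :
    G.onEdge u a.1 (G.endCoord a) = u (G.endPt a) := by
  rw [onEdge_of_mem _ _ _ (G.endCoord_mem a), endPt_eq_pt]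

lemma exists_pt (p : G.Point) : ∃ e x, p = G.pt e x := by
  induction p using Quotient.inductionOn with
  | h p => exact ⟨p.1, p.2, rfl⟩

lemma continuous_pt (e : E) : Continuous (G.pt e) :=
  continuous_quotient_mk'.comp continuous_sigmaMk

lemma continuous_onEdge {u : G.Point → ℝ} (hu : Continuous u) (e : E) :
    Continuous (G.onEdge u e) :=
  (hu.comp (G.continuous_pt e)).Icc_extend'

/-- The function on `G` with given restrictions to the edges and given values at the vertices. -/
def glue (f : E → ℝ → ℝ) (X : V → ℝ) (h : ∀ a : E × Bool, f a.1 (G.endCoord a) = X (G.vert a)) :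
    G.Point → ℝ :=
  Quotient.lift (fun p : G.PrePoint => f p.1 p.2) (by
    rintro p p' (rfl | ⟨a, b, rfl, rfl, hab⟩)
    · rfl
    · rw [preEnd_eq, preEnd_eq]
      exact (h a).trans ((congrArg X hab).trans (h b).symm))

lemma glue_pt (f : E → ℝ → ℝ) (X : V → ℝ) (h) (e : E) (x : Set.Icc (0 : ℝ) (G.len e)) :
    G.glue f X h (G.pt e x) = f e x := rfl

lemma onEdge_glue (f : E → ℝ → ℝ) (X : V → ℝ) (h) (e : E) {x : ℝ}
    (hx : x ∈ Set.Icc 0 (G.len e)) : G.onEdge (G.glue f X h) e x = f e x := by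
  rw [onEdge_of_mem _ _ _ hx, glue_pt]

lemma glue_endPt (f : E → ℝ → ℝ) (X : V → ℝ) (h) (a : E × Bool) :
    G.glue f X h (G.endPt a) = X (G.vert a) := by
  rw [endPt_eq_pt, glue_pt, h]

lemma continuous_glue {f : E → ℝ → ℝ} (X : V → ℝ) (h) (hf : ∀ e, Continuous (f e)) :
    Continuous (G.glue f X h) :=
  Continuous.quotient_lift
    (continuous_sigma fun e => (hf e).comp continuous_subtype_val) _

lemma finite_vertices (G : MetricGraph V E) [Finite E] : Finite V := Finite.of_surjective _ G.vert_surjective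

/-! ### Classical solutions -/

lemma hasSobolevDeriv_of_hasDerivWithinAt {l : ℝ} {f g : ℝ → ℝ}
    (hf : ∀ x ∈ Set.Icc 0 l, HasDerivWithinAt f (g x) (Set.Icc 0 l) x)
    (hg : ContinuousOn g (Set.Icc 0 l)) : HasSobolevDeriv l f g := by
  constructor
  · obtain ⟨C, hC⟩ := isCompact_Icc.exists_bound_of_continuousOn hg
    exact MemLp.of_bound (hg.aestronglyMeasurable measurableSet_Icc) C
      ((ae_restrict_iff' measurableSet_Icc).2 (Filter.Eventually.of_forall hC))
  · intro x hx
    have hsub : Set.Icc 0 x ⊆ Set.Icc 0 l := Set.Icc_subset_Icc_right hx.2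
    rw [intervalIntegral.integral_eq_sub_of_hasDerivAt_of_le hx.1
      (fun y hy => ((hf y (hsub hy)).continuousWithinAt).mono hsub)
      (fun y hy => (hf y (hsub ⟨hy.1.le, hy.2.le⟩)).hasDerivAt
        (Icc_mem_nhds hy.1 (hy.2.trans_le hx.2)))]
    · ring
    · exact (hg.mono (by rw [Set.uIcc_of_le hx.1]; exact hsub)).intervalIntegrable

lemma HasSobolevDeriv.hasDerivWithinAt {l : ℝ} {f g g' : ℝ → ℝ} (h : HasSobolevDeriv l f g)
    (hg' : Continuous g')
    (hgg' : ∀ᵐ x ∂volume.restrict (Set.Icc 0 l), g x = g' x) {x : ℝ} (hx : x ∈ Set.Icc 0 l) :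
    HasDerivWithinAt f (g' x) (Set.Icc 0 l) x := by
  have key : ∀ y ∈ Set.Icc 0 l, f y = f 0 + ∫ t in (0 : ℝ)..y, g' t := by
    intro y hy
    rw [h.2 y hy]
    congr 1
    refine intervalIntegral.integral_congr_ae_restrict ?_
    rw [Set.uIoc_of_le hy.1]
    exact ae_restrict_of_ae_restrict_of_subset
      (Set.Ioc_subset_Icc_self.trans (Set.Icc_subset_Icc_right hy.2)) hgg'
  have hd : HasDerivAt (fun y => f 0 + ∫ t in (0 : ℝ)..y, g' t) (g' x) x :=
    (hg'.integral_hasStrictDerivAt 0 x).hasDerivAt.const_add _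
  exact hd.hasDerivWithinAt.congr key (key x hx)

/-- `u` is a classical solution of `-u'' + q u = mu u` on `G` with standard vertex conditions, and
`d` is its derivative. -/
structure IsClassicalSolution [Fintype E] [DecidableEq V] (q : G.Point → ℝ) (mu : ℝ)
    (u : G.Point → ℝ) (d : E → ℝ → ℝ) : Prop where
  continuous : Continuous u
  hasDeriv : ∀ e, ∀ x ∈ Set.Icc 0 (G.len e),
    HasDerivWithinAt (G.onEdge u e) (d e x) (Set.Icc 0 (G.len e)) x
  hasDeriv_deriv : ∀ e, ∀ x ∈ Set.Icc 0 (G.len e),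
    HasDerivWithinAt (d e) ((G.onEdge q e x - mu) * G.onEdge u e x) (Set.Icc 0 (G.len e)) x
  kirchhoff : ∀ v, ∑ a : E × Bool with G.vert a = v, G.normalDeriv d a = 0

variable {G} [Fintype E] [DecidableEq V] {q u : G.Point → ℝ} {mu : ℝ} {d : E → ℝ → ℝ}

lemma IsClassicalSolution.mem_eigenspace (hq : Continuous q)
    (h : G.IsClassicalSolution q mu u d) : u ∈ G.eigenspace q mu := by
  refine ⟨h.continuous, d, fun e x => (G.onEdge q e x - mu) * G.onEdge u e x, fun e => ?_,
    fun e => ?_, h.kirchhoff, fun e => ?_⟩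
  · exact hasSobolevDeriv_of_hasDerivWithinAt (h.hasDeriv e)
      fun x hx => (h.hasDeriv_deriv e x hx).continuousWithinAt
  · refine hasSobolevDeriv_of_hasDerivWithinAt (h.hasDeriv_deriv e) (Continuous.continuousOn ?_)
    exact ((G.continuous_onEdge hq e).sub continuous_const).mul (G.continuous_onEdge h.continuous e)
  · refine Filter.Eventually.of_forall fun x => ?_
    rw [onEdge_smul]
    ring

/-- Elliptic regularity in dimension one: the weak second derivative equals the continuous function
(q - mu) u almost everywhere, so d is continuously differentiable, and then so is u. -/
lemma exists_isClassicalSolution (hq : Continuous q) (hu : u ∈ G.eigenspace q mu) :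
    ∃ d, G.IsClassicalSolution q mu u d := by
  obtain ⟨hc, d, dd, h1, h2, h3, h4⟩ := hu
  have hd : ∀ e, ∀ x ∈ Set.Icc 0 (G.len e),
      HasDerivWithinAt (d e) ((G.onEdge q e x - mu) * G.onEdge u e x) (Set.Icc 0 (G.len e)) x := by
    intro e x hx
    refine (h2 e).hasDerivWithinAt (g' := fun x => (G.onEdge q e x - mu) * G.onEdge u e x) ?_ ?_ hx
    · exact ((G.continuous_onEdge hq e).sub continuous_const).mul (G.continuous_onEdge hc e)
    · filter_upwards [h4 e] with y hy
      rw [onEdge_smul] at hy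
      linear_combination -hy
  refine ⟨d, hc, fun e x hx => ?_, hd, h3⟩
  have hcont : Continuous (Set.IccExtend (G.len_nonneg e) (Set.domRestrict _ (d e))) :=
    (continuousOn_iff_continuous_domRestrict.1
      fun y hy => (hd e y hy).continuousWithinAt).Icc_extend'
  have := (h1 e).hasDerivWithinAt hcont ?_ hx
  · rwa [Set.IccExtend_of_mem _ _ hx] at this
  · refine (ae_restrict_iff' measurableSet_Icc).2 (Filter.Eventually.of_forall fun y hy => ?_)
    rw [Set.IccExtend_of_mem _ _ hy]
    rfl

/-- Edgewise functions that solve the equation and match at the vertices yield a classical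
solution. -/
lemma isClassicalSolution_glue {f d : E → ℝ → ℝ} {X : V → ℝ}
    (h : ∀ a : E × Bool, f a.1 (G.endCoord a) = X (G.vert a))
    (hf : ∀ e x, HasDerivAt (f e) (d e x) x)
    (hd : ∀ e, ∀ x ∈ Set.Icc 0 (G.len e),
      HasDerivAt (d e) ((G.onEdge q e x - mu) * f e x) x)
    (hk : ∀ v, ∑ a : E × Bool with G.vert a = v, G.normalDeriv d a = 0) :
    G.IsClassicalSolution q mu (G.glue f X h) d where
  continuous := G.continuous_glue X h fun e =>
    continuous_iff_continuousAt.2 fun x => (hf e x).continuousAt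
  hasDeriv e x hx := (hf e x).hasDerivWithinAt.congr
    (fun y hy => G.onEdge_glue f X h e hy) (G.onEdge_glue f X h e hx)
  hasDeriv_deriv e x hx := by
    rw [G.onEdge_glue f X h e hx]
    exact (hd e x hx).hasDerivWithinAt
  kirchhoff := hk

/-! ### Positive eigenfunctions belong to the lowest eigenvalue -/

lemma sum_ends_eq (w : E × Bool → ℝ) :
    ∑ a, w a = ∑ e, (w (e, false) + w (e, true)) := by
  rw [Fintype.sum_prod_type]
  exact Finset.sum_congr rfl fun e _ => by rw [Fintype.sum_bool, add_comm]

/-- A sum over all ends of a vertex function times an end function whose sum vanishes at each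
vertex is zero. -/
lemma sum_mul_eq_zero_of_kirchhoff [Finite V] {w : E × Bool → ℝ}
    (hw : ∀ v, ∑ a : E × Bool with G.vert a = v, w a = 0) {y : E × Bool → ℝ}
    (hy : ∀ a b, G.vert a = G.vert b → y a = y b) : ∑ a, y a * w a = 0 := by
  have := Fintype.ofFinite V
  rw [← Finset.sum_fiberwise Finset.univ G.vert]
  refine Finset.sum_eq_zero fun v _ => ?_
  obtain ⟨b, rfl⟩ := G.vert_surjective v
  rw [Finset.sum_congr rfl (g := fun a => y b * w a), ← Finset.mul_sum, hw, mul_zero]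
  intro a ha
  rw [hy a b (Finset.mem_filter.1 ha).2]

/-- If there is a positive eigenfunction with eigenvalue `lam`, there is no eigenvalue below
`lam`. -/
lemma eq_zero_of_lt_of_pos {lam : ℝ} {phi : G.Point → ℝ} {d' : E → ℝ → ℝ}
    (hphi : G.IsClassicalSolution q lam phi d') (hpos : ∀ p, 0 < phi p)
    (hu : G.IsClassicalSolution q mu u d) (hlt : mu < lam) : u = 0 := by
  have := G.finite_vertices
  let f e := G.onEdge u e
  let g e := G.onEdge phi e
  have hg : ∀ e x, 0 < g e x := fun e x => hpos _
  -- Picone's identity: on replacing both second derivatives by means of the equations, q cancels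
  -- and the derivative of `D` becomes a sum of two nonnegative terms, the second of which detects
  -- f.
  let D : E → ℝ → ℝ := fun e x => f e x * d e x - f e x ^ 2 / g e x * d' e x
  let D' : E → ℝ → ℝ := fun e x =>
    (d e x - f e x * d' e x / g e x) ^ 2 + (lam - mu) * f e x ^ 2
  have hD : ∀ e, ∀ x ∈ Set.Icc 0 (G.len e),
      HasDerivWithinAt (D e) (D' e x) (Set.Icc 0 (G.len e)) x := by
    intro e x hx
    have h1 := hu.hasDeriv e x hx
    have h2 := hu.hasDeriv_deriv e x hx
    have h3 := hphi.hasDeriv e x hx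
    have h4 := hphi.hasDeriv_deriv e x hx
    have hne : G.onEdge phi e x ≠ 0 := (hg e x).ne'
    refine ((h1.fun_mul h2).fun_sub (((h1.fun_pow 2).fun_div h3 hne).fun_mul h4)).congr_deriv ?_
    simp only [D', f, g]
    field_simp
    ring
  have hmono : ∀ e, MonotoneOn (D e) (Set.Icc 0 (G.len e)) := fun e =>
    monotoneOn_of_hasDerivWithinAt_nonneg (convex_Icc _ _)
      (fun x hx => (hD e x hx).continuousWithinAt)
      (fun x hx => (hD e x (interior_subset hx)).mono interior_subset)
      (fun x _ => add_nonneg (sq_nonneg _) (mul_nonneg (sub_nonneg.2 hlt.le) (sq_nonneg _)))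
  -- The boundary terms are vertex functions times normal derivatives, so both Kirchhoff conditions
  -- annihilate them; each `D e`, being monotone, must then be constant.
  have hsum : ∑ e, (D e (G.len e) - D e 0) = 0 := by
    have e1 : ∀ e, D e (G.len e) - D e 0 =
        G.normalDeriv D (e, false) + G.normalDeriv D (e, true) := by
      intro e
      simp only [normalDeriv]
      ring
    rw [Finset.sum_congr rfl fun e _ => e1 e, ← sum_ends_eq]
    have e2 : ∀ a, G.normalDeriv D a = u (G.endPt a) * G.normalDeriv d a
        - u (G.endPt a) ^ 2 / phi (G.endPt a) * G.normalDeriv d' a := by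
      intro a
      rw [← G.onEdge_endCoord u a, ← G.onEdge_endCoord phi a]
      rcases a with ⟨e, _ | _⟩
      · simp only [normalDeriv, endCoord, D, f, g, Bool.false_eq_true, if_false]
        ring
      · simp [normalDeriv, endCoord, D, f, g]
    rw [Finset.sum_congr rfl fun a _ => e2 a, Finset.sum_sub_distrib,
      sum_mul_eq_zero_of_kirchhoff hu.kirchhoff, sum_mul_eq_zero_of_kirchhoff hphi.kirchhoff,
      sub_zero]
    · intro a b hab; rw [G.endPt_congr hab]
    · intro a b hab; rw [G.endPt_congr hab]
  have hnn : ∀ e ∈ Finset.univ, 0 ≤ D e (G.len e) - D e 0 := fun e _ =>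
    sub_nonneg.2 (hmono e ⟨le_rfl, G.len_nonneg e⟩ ⟨G.len_nonneg e, le_rfl⟩ (G.len_nonneg e))
  have hzero := (Finset.sum_eq_zero_iff_of_nonneg hnn).1 hsum
  have hconst : ∀ e, ∀ x ∈ Set.Icc 0 (G.len e), D e x = D e 0 := by
    intro e x hx
    have h1 := hmono e ⟨le_rfl, G.len_nonneg e⟩ hx hx.1
    have h2 := hmono e hx ⟨G.len_nonneg e, le_rfl⟩ hx.2
    have h3 := hzero e (Finset.mem_univ e)
    linarith
  funext p
  obtain ⟨e, x, rfl⟩ := G.exists_pt p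
  have h0 : HasDerivWithinAt (D e) 0 (Set.Icc 0 (G.len e)) x :=
    (hasDerivWithinAt_const (x : ℝ) _ (D e 0)).congr (hconst e) (hconst e x x.2)
  have h1 := (uniqueDiffOn_Icc (G.len_pos e) x x.2).eq_deriv _ (hD e x x.2) h0
  have h2 : f e x = 0 := by
    have h3 : (lam - mu) * f e x ^ 2 = 0 := by
      have := mul_nonneg (sub_nonneg.2 hlt.le) (sq_nonneg (f e x))
      have := sq_nonneg (d e x - f e x * d' e x / g e x)
      simp only [D'] at h1
      linarith
    simpa [(sub_pos.2 hlt).ne'] using h3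
  simpa [f, G.onEdge_of_mem u e x.2] using h2

/-- A solution of the free equation that vanishes at a leaf vanishes on the edge of that leaf. -/
lemma onEdge_eq_zero_of_leaf (hmu : 0 ≤ mu) (hu : G.IsClassicalSolution 0 mu u d) {b : E × Bool}
    (hb : ∀ a, G.vert a = G.vert b → a = b) (hub : u (G.endPt b) = 0) :
    ∀ x ∈ Set.Icc 0 (G.len b.1), G.onEdge u b.1 x = 0 := by
  have hdb : d b.1 (G.endCoord b) = 0 := by
    have h := hu.kirchhoff (G.vert b)
    have hs : (Finset.univ.filter fun a => G.vert a = G.vert b) = {b} := by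
      ext a
      simpa using ⟨hb a, fun h => h ▸ rfl⟩
    rw [hs, Finset.sum_singleton] at h
    rcases b with ⟨e, _ | _⟩ <;> simpa [normalDeriv, endCoord] using h
  rw [← G.onEdge_endCoord u b] at hub
  set e := b.1
  set f := G.onEdge u e
  have hconst : ∀ (D : ℝ → ℝ), (∀ x ∈ Set.Icc 0 (G.len e),
      HasDerivWithinAt D 0 (Set.Icc 0 (G.len e)) x) →
      ∀ x ∈ Set.Icc 0 (G.len e), D x = D (G.endCoord b) := by
    intro D hD x hx
    have key := constant_of_derivWithin_zero (fun y hy => (hD y hy).differentiableWithinAt)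
      (fun y hy => (hD y (Set.Ico_subset_Icc_self hy)).derivWithin
        (uniqueDiffOn_Icc (G.len_pos e) y (Set.Ico_subset_Icc_self hy)))
    rw [key x hx, key _ (G.endCoord_mem b)]
  have hd0 : ∀ x ∈ Set.Icc 0 (G.len e), d e x = 0 := by
    intro x hx
    -- Conserved energy of the oscillator, zero at the leaf. For `mu = 0` it controls only d, which
    -- suffices because f is then constant.
    have h := hconst (fun x => d e x ^ 2 + mu * f x ^ 2) (fun y hy => by
      refine (((hu.hasDeriv_deriv e y hy).fun_pow 2).fun_add
        (((hu.hasDeriv e y hy).fun_pow 2).const_mul mu)).congr_deriv ?_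
      have : G.onEdge (0 : G.Point → ℝ) e y = 0 := rfl
      rw [this]
      ring) x hx
    simp only [hdb, hub] at h
    have h1 := mul_nonneg hmu (sq_nonneg (f x))
    have h2 : d e x ^ 2 = 0 := by
      have := sq_nonneg (d e x)
      norm_num at h
      linarith
    simpa using h2
  intro x hx
  rw [hconst f (fun y hy => by simpa [hd0 y hy] using hu.hasDeriv e y hy) x hx, hub]

/-! ### Eigenvalues -/

lemma le_of_eigenspace_ne_bot {lam : ℝ} {phi : G.Point → ℝ} (hq : Continuous q)
    (hphi : phi ∈ G.eigenspace q lam) (hpos : ∀ p, 0 < phi p) (h : u ∈ G.eigenspace q mu)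
    (hu : u ≠ 0) : lam ≤ mu := by
  obtain ⟨d', hd'⟩ := exists_isClassicalSolution hq hphi
  obtain ⟨d, hd⟩ := exists_isClassicalSolution hq h
  by_contra! hlt
  exact hu (eq_zero_of_lt_of_pos hd' hpos hd hlt)

lemma le_of_one_le_rank {lam r : ℝ} {phi : G.Point → ℝ} (hq : Continuous q)
    (hphi : phi ∈ G.eigenspace q lam) (hpos : ∀ p, 0 < phi p)
    (hr : 1 ≤ Module.rank ℝ (⨆ mu : Set.Iic r, G.eigenspace q mu : Submodule ℝ (G.Point → ℝ))) :
    lam ≤ r := by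
  by_contra! hlt
  have hbot : (⨆ mu : Set.Iic r, G.eigenspace q mu : Submodule ℝ (G.Point → ℝ)) = ⊥ := by
    refine iSup_eq_bot.2 fun mu => (Submodule.eq_bot_iff _).2 fun u hu => ?_
    by_contra h0
    exact absurd (le_of_eigenspace_ne_bot hq hphi hpos hu h0) (not_le.2 (mu.2.trans_lt hlt))
  rw [hbot] at hr
  simp at hr

/-- The eigenvalue of a positive eigenfunction is the lowest one. -/
lemma eigenvalue_one_eq [Nonempty G.Point] {lam : ℝ} {phi : G.Point → ℝ} (hq : Continuous q)
    (hphi : phi ∈ G.eigenspace q lam) (hpos : ∀ p, 0 < phi p) : G.eigenvalue q 1 = lam := by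
  have hphi0 : phi ≠ 0 := by
    rintro rfl
    exact lt_irrefl _ (hpos (Classical.arbitrary _))
  suffices h : IsLeast {r : ℝ | ((1 : ℕ) : Cardinal) ≤
      Module.rank ℝ (⨆ mu : Set.Iic r, G.eigenspace q mu : Submodule ℝ (G.Point → ℝ))} lam from
    h.csInf_eq
  constructor
  · have hmem : phi ∈ (⨆ mu : Set.Iic lam, G.eigenspace q mu : Submodule ℝ (G.Point → ℝ)) :=
      Submodule.mem_iSup_of_mem (⟨lam, Set.self_mem_Iic⟩ : Set.Iic lam) hphi
    simp only [Set.mem_ofPred_eq, Nat.cast_one, Cardinal.one_le_iff_ne_zero]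
    rw [← pos_iff_ne_zero, rank_pos_iff_exists_ne_zero]
    exact ⟨⟨phi, hmem⟩, fun h => hphi0 (congrArg Subtype.val h)⟩
  · intro r hr
    exact le_of_one_le_rank hq hphi hpos (by simpa using hr)

/-- The positive eigenfunction serves twice: it bounds the set in the infimum from below, and, since
`lam ≤ mu`, it supplies the second dimension next to u. -/
lemma eigenvalue_two_le {lam : ℝ} {phi : G.Point → ℝ} (hq : Continuous q)
    (hphi : phi ∈ G.eigenspace q lam) (hpos : ∀ p, 0 < phi p) (hu : u ∈ G.eigenspace q mu)
    (hli : LinearIndependent ℝ ![phi, u]) : G.eigenvalue q 2 ≤ mu := by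
  refine csInf_le ⟨lam, fun r hr => ?_⟩ ?_
  · exact le_of_one_le_rank hq hphi hpos (le_trans (by exact_mod_cast one_le_two) (Set.mem_ofPred.1 hr))
  · have hle : lam ≤ mu := le_of_eigenspace_ne_bot hq hphi hpos hu (hli.ne_zero 1)
    set W := (⨆ mu' : Set.Iic mu, G.eigenspace q mu' : Submodule ℝ (G.Point → ℝ))
    have h1 : phi ∈ W := Submodule.mem_iSup_of_mem (⟨lam, hle⟩ : Set.Iic mu) hphi
    have h2 : u ∈ W := Submodule.mem_iSup_of_mem (⟨mu, Set.self_mem_Iic⟩ : Set.Iic mu) hu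
    have hli' : LinearIndependent ℝ (![⟨phi, h1⟩, ⟨u, h2⟩] : Fin 2 → W) := by
      refine LinearIndependent.of_comp W.subtype ?_
      convert hli using 1
      ext i
      fin_cases i <;> rfl
    simpa using hli'.cardinal_lift_le_rank

end MetricGraph

namespace MetricGraph

variable {V E : Type*} (G : MetricGraph V E)

/-! ### The Helmholtz equation on the edges with prescribed values at the vertices -/

/-- The derivative, pointing out of the vertex, at the end `a` of an edge, of the solution of
`-f'' = k² f` on this edge with values `x` at the vertices. -/
def outDeriv (k : ℝ) (x : V → ℝ) (a : E × Bool) : ℝ :=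
  (x (G.vert (a.1, !a.2)) - Real.cos (k * G.len a.1) * x (G.vert a)) /
    (G.len a.1 * Real.sinc (k * G.len a.1))

/-- Writing sin(k l)/k as l sinc(k l) makes the formula meaningful and continuous at k = 0, where it
is the slope of the affine interpolation. -/
lemma outDeriv_zero (x : V → ℝ) (a : E × Bool) :
    G.outDeriv 0 x a = (x (G.vert (a.1, !a.2)) - x (G.vert a)) / G.len a.1 := by
  simp [outDeriv]

lemma continuousAt_outDeriv {x : ℝ → V → ℝ} (hx : ContinuousAt x 0) (a : E × Bool) :
    ContinuousAt (fun k => G.outDeriv k (x k) a) 0 := by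
  have h := fun v => continuousAt_pi.1 hx v
  have hs := Real.continuous_sinc
  refine ContinuousAt.div ((h _).sub (ContinuousAt.mul ?_ (h _))) ?_ ?_
  · fun_prop
  · fun_prop
  · simpa using (G.len_pos a.1).ne'

lemma eq_of_connected (hconn : (SimpleGraph.fromEdgeSet (Set.range G.edgeEnds)).Connected)
    {x : V → ℝ} (hx : ∀ e, x (G.vert (e, false)) = x (G.vert (e, true))) (v w : V) :
    x v = x w := by
  obtain ⟨p⟩ := hconn.preconnected v w
  induction p with
  | nil => rfl
  | cons h p ih =>
    rw [← ih]
    obtain ⟨⟨e, he⟩, -⟩ := (SimpleGraph.fromEdgeSet_adj _).1 h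
    rcases Sym2.eq_iff.1 he with ⟨h1, h2⟩ | ⟨h1, h2⟩
    · rw [← h1, ← h2, hx]
    · rw [← h1, ← h2, hx]

variable [Fintype E] [DecidableEq V]

/-- The operator that returns the values at `v₀` and `b`, and the sums of the outward derivatives
at all other vertices. -/
def vertexOperator (v₀ b : V) (k : ℝ) : (V → ℝ) →ₗ[ℝ] (V → ℝ) where
  toFun x v := if v = v₀ ∨ v = b then x v else ∑ a : E × Bool with G.vert a = v, G.outDeriv k x a
  map_add' x y := by
    funext v
    by_cases hv : v = v₀ ∨ v = b
    · simp [hv]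
    · simp only [hv, if_false, Pi.add_apply, ← Finset.sum_add_distrib]
      exact Finset.sum_congr rfl fun a _ => by simp only [outDeriv, Pi.add_apply]; ring
  map_smul' c x := by
    funext v
    by_cases hv : v = v₀ ∨ v = b
    · simp [hv]
    · simp only [hv, if_false, Pi.smul_apply, smul_eq_mul, Finset.mul_sum, RingHom.id_apply]
      exact Finset.sum_congr rfl fun a _ => by
        simp only [outDeriv, Pi.smul_apply, smul_eq_mul]; ring

lemma vertexOperator_apply (v₀ b : V) (k : ℝ) (x : V → ℝ) (v : V) :
    G.vertexOperator v₀ b k x v = if v = v₀ ∨ v = b then x v else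
      ∑ a : E × Bool with G.vert a = v, G.outDeriv k x a := rfl

/-- Discrete Dirichlet energy: pairing x with its outward derivatives gives minus the sum of
(difference)²/length over the edges. Every vertex contributes zero, so x is constant by
connectedness, and it vanishes at `v₀`. -/
lemma eq_zero_of_vertexOperator_zero
    (hconn : (SimpleGraph.fromEdgeSet (Set.range G.edgeEnds)).Connected) (v₀ b : V) {x : V → ℝ}
    (hx : G.vertexOperator v₀ b 0 x = 0) : x = 0 := by
  have := G.finite_vertices
  have := Fintype.ofFinite V
  have hv : ∀ v, x v * ∑ a : E × Bool with G.vert a = v, G.outDeriv 0 x a = 0 := by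
    intro v
    have h := congrFun hx v
    rw [vertexOperator_apply] at h
    split_ifs at h with h0
    · simp [h]
    · simp [h]
  have hsum : ∑ a, x (G.vert a) * G.outDeriv 0 x a = 0 := by
    rw [← Finset.sum_fiberwise Finset.univ G.vert]
    refine Finset.sum_eq_zero fun v _ => ?_
    refine Eq.trans ?_ (hv v)
    rw [Finset.mul_sum]
    refine Finset.sum_congr rfl fun a ha => ?_
    rw [(Finset.mem_filter.1 ha).2]
  rw [sum_ends_eq] at hsum
  have hterm : ∀ e, x (G.vert (e, false)) * G.outDeriv 0 x (e, false) +
      x (G.vert (e, true)) * G.outDeriv 0 x (e, true) =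
      -((x (G.vert (e, false)) - x (G.vert (e, true))) ^ 2 / G.len e) := by
    intro e
    simp only [outDeriv_zero, Bool.not_false, Bool.not_true]
    ring
  rw [Finset.sum_congr rfl fun e _ => hterm e, Finset.sum_neg_distrib, neg_eq_zero,
    Finset.sum_eq_zero_iff_of_nonneg
      fun e _ => div_nonneg (sq_nonneg _) (G.len_nonneg e)] at hsum
  have hedge : ∀ e, x (G.vert (e, false)) = x (G.vert (e, true)) := by
    intro e
    have h := hsum e (Finset.mem_univ e)
    rw [div_eq_zero_iff, or_iff_left (G.len_pos e).ne', sq_eq_zero_iff, sub_eq_zero] at h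
    exact h
  funext v
  rw [G.eq_of_connected hconn hedge v v₀]
  simpa [vertexOperator_apply] using congrFun hx v₀

open scoped Matrix in
/-- For small `k` there are vertex values, close to `1`, of a solution of the Helmholtz equation
that satisfies the Kirchhoff condition at all vertices but two. -/
lemma exists_vertexValues
    (hconn : (SimpleGraph.fromEdgeSet (Set.range G.edgeEnds)).Connected) (v₀ b : V) :
    ∃ x : ℝ → V → ℝ, ContinuousAt x 0 ∧ x 0 = 1 ∧ ∀ᶠ k in nhds 0, x k v₀ = 1 ∧
      ∀ v, v ≠ v₀ → v ≠ b → ∑ a : E × Bool with G.vert a = v, G.outDeriv k (x k) a = 0 := by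
  have := G.finite_vertices
  have := Fintype.ofFinite V
  let A : ℝ → Matrix V V ℝ := fun k => LinearMap.toMatrix' (G.vertexOperator v₀ b k)
  -- This right-hand side is the image of the constant 1 at k = 0. In the application b is the leaf;
  -- its prescribed value does not matter, as its edge is discarded later.
  let r : V → ℝ := fun v => if v = v₀ ∨ v = b then 1 else 0
  have hA : ContinuousAt A 0 := by
    refine continuousAt_pi.2 fun v => continuousAt_pi.2 fun w => ?_
    simp only [A, LinearMap.toMatrix'_apply, vertexOperator_apply]
    by_cases hv : v = v₀ ∨ v = b
    · simp only [hv, if_true]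
      exact continuousAt_const
    · simp only [hv, if_false]
      exact tendsto_finsetSum _ fun a _ => G.continuousAt_outDeriv continuousAt_const a
  have hA1 : A 0 *ᵥ 1 = r := by
    simp only [A, LinearMap.toMatrix'_mulVec]
    funext v
    rw [vertexOperator_apply]
    by_cases hv : v = v₀ ∨ v = b
    · simp [hv, r]
    · simp only [hv, if_false, r]
      exact Finset.sum_eq_zero fun a _ => by simp [outDeriv_zero]
  have hdet : (A 0).det ≠ 0 := by
    intro h
    obtain ⟨x, hx0, hx⟩ := Matrix.exists_mulVec_eq_zero_iff.2 h
    rw [LinearMap.toMatrix'_mulVec] at hx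
    exact hx0 (G.eq_zero_of_vertexOperator_zero hconn v₀ b hx)
  have hdetc : ContinuousAt (fun k => (A k).det) 0 :=
    (Continuous.matrix_det continuous_id).continuousAt.comp hA
  refine ⟨fun k => (A k)⁻¹ *ᵥ r, ?_, ?_, ?_⟩
  · have hadj : ContinuousAt (fun k => (A k).adjugate) 0 :=
      (Continuous.matrix_adjugate continuous_id).continuousAt.comp hA
    have hinv : ContinuousAt (fun k => (A k)⁻¹) 0 := by
      simp only [Matrix.inv_def, Ring.inverse_eq_inv']
      exact (hdetc.inv₀ hdet).smul hadj
    exact ((continuous_id.matrix_mulVec continuous_const).continuousAt).comp hinv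
  · change (A 0)⁻¹ *ᵥ r = 1
    rw [← hA1, Matrix.mulVec_mulVec, Matrix.nonsing_inv_mul _ (isUnit_iff_ne_zero.2 hdet),
      Matrix.one_mulVec]
  · filter_upwards [hdetc.eventually_ne hdet] with k hk
    have h : G.vertexOperator v₀ b k ((A k)⁻¹ *ᵥ r) = r := by
      rw [← LinearMap.toMatrix'_mulVec]
      change A k *ᵥ _ = r
      rw [Matrix.mulVec_mulVec, Matrix.mul_nonsing_inv _ (isUnit_iff_ne_zero.2 hk),
        Matrix.one_mulVec]
    constructor
    · simpa [vertexOperator_apply, r] using congrFun h v₀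
    · intro v h1 h2
      simpa [vertexOperator_apply, r, h1, h2] using congrFun h v

end MetricGraph

/-! ### Convexity along paths -/

lemma ConvexOn.comp_of_mapsTo {D I : Set ℝ} {Q h : ℝ → ℝ} (hQ : ConvexOn ℝ I Q)
    (hmono : MonotoneOn Q I) (hh : ConvexOn ℝ D h) (hmaps : Set.MapsTo h D I) :
    ConvexOn ℝ D (fun t => Q (h t)) := by
  refine ⟨hh.1, fun x hx y hy a b ha hb hab => ?_⟩
  exact (hmono (hmaps (hh.1 hx hy ha hb hab)) (hQ.1 (hmaps hx) (hmaps hy) ha hb hab)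
    (hh.2 hx hy ha hb hab)).trans (hQ.2 (hmaps hx) (hmaps hy) ha hb hab)

section Excursion

variable {L l : ℝ} {g : ℝ → ℝ}

/-- A continuous function that is injective where it is positive, and zero at both ends of an
interval, vanishes. -/
lemma eq_zero_of_injOn_pos (hg : ContinuousOn g (Set.Icc 0 L))
    (hnn : ∀ t ∈ Set.Icc 0 L, 0 ≤ g t)
    (hinj : ∀ s ∈ Set.Icc 0 L, ∀ t ∈ Set.Icc 0 L, 0 < g s → g s = g t → s = t)
    (h0 : g 0 = 0) (hL : g L = 0) : ∀ t ∈ Set.Icc 0 L, g t = 0 := by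
  intro t ht
  by_contra hne
  have hpos : 0 < g t := lt_of_le_of_ne (hnn t ht) (Ne.symm hne)
  -- Half the height is attained both before and after t; injectivity forces the two times to
  -- coincide with t.
  obtain ⟨s, hs, hgs⟩ := intermediate_value_Icc ht.1
    (hg.mono (Set.Icc_subset_Icc_right ht.2)) (show g t / 2 ∈ Set.Icc (g 0) (g t) by
      constructor <;> linarith)
  obtain ⟨r, hr, hgr⟩ := intermediate_value_Icc' ht.2
    (hg.mono (Set.Icc_subset_Icc_left ht.1)) (show g t / 2 ∈ Set.Icc (g L) (g t) by
      constructor <;> linarith)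
  have hsr := hinj s ⟨hs.1, hs.2.trans ht.2⟩ r ⟨ht.1.trans hr.1, hr.2⟩ (by linarith)
    (by linarith)
  have hst : s = t := le_antisymm hs.2 (hsr ▸ hr.1)
  rw [hst] at hgs
  linarith

/-- A function that descends from `l` to `0`, injective and of unit speed where it is positive. -/
lemma eq_max_of_injOn_pos (hg : ContinuousOn g (Set.Icc 0 L))
    (hnn : ∀ t ∈ Set.Icc 0 L, 0 ≤ g t) (hle : ∀ t ∈ Set.Icc 0 L, g t ≤ l) (hl : 0 < l)
    (hinj : ∀ s ∈ Set.Icc 0 L, ∀ t ∈ Set.Icc 0 L, 0 < g s → g s = g t → s = t)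
    (hspeed : ∀ s t, 0 ≤ s → s ≤ t → t ≤ L → (∀ r ∈ Set.Icc s t, 0 < g r) →
      |g t - g s| = t - s)
    (h0 : g 0 = l) : ∀ t ∈ Set.Icc 0 L, g t = max (l - t) 0 := by
  have hpos : ∀ t ∈ Set.Icc 0 L, 0 < g t → g t = l - t := by
    intro t ht hgt
    -- A zero before t would make g take the level g t / 2 on both sides of it. Hence g stays
    -- positive up to t and the unit speed applies on all of [0, t].
    have hall : ∀ r ∈ Set.Icc 0 t, 0 < g r := by
      intro r hr
      have hrL : r ∈ Set.Icc 0 L := ⟨hr.1, hr.2.trans ht.2⟩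
      by_contra hneg
      have hgr : g r = 0 := le_antisymm (not_lt.1 hneg) (hnn r hrL)
      have hcl : g t ≤ l := hle t ht
      obtain ⟨s, hs, hgs⟩ := intermediate_value_Icc' hr.1
        (hg.mono (Set.Icc_subset_Icc_right hrL.2)) (show g t / 2 ∈ Set.Icc (g r) (g 0) by
          constructor <;> linarith)
      obtain ⟨s', hs', hgs'⟩ := intermediate_value_Icc hr.2
        (hg.mono (Set.Icc_subset_Icc hr.1 ht.2)) (show g t / 2 ∈ Set.Icc (g r) (g t) by
          constructor <;> linarith)
      have hss := hinj s ⟨hs.1, hs.2.trans hrL.2⟩ s' ⟨hr.1.trans hs'.1, hs'.2.trans ht.2⟩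
        (by linarith) (by linarith)
      have hsr : s = r := le_antisymm hs.2 (hss ▸ hs'.1)
      rw [hsr] at hgs
      linarith
    have h := hspeed 0 t le_rfl ht.1 ht.2 hall
    rw [h0, abs_of_nonpos (by linarith [hle t ht])] at h
    linarith
  intro t ht
  rcases (hnn t ht).lt_or_eq with h | h
  · rw [hpos t ht h, max_eq_left]
    rw [hpos t ht h] at h
    exact h.le
  · rw [← h, max_eq_right]
    -- If g vanished before time l, it would take the value (l - t)/2 at some r ≤ t, although there
    -- g r = l - r ≥ l - t.
    by_contra hlt
    push Not at hlt
    have ht0 := ht.1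
    obtain ⟨r, hr, hgr⟩ := intermediate_value_Icc' ht.1
      (hg.mono (Set.Icc_subset_Icc_right ht.2)) (show (l - t) / 2 ∈ Set.Icc (g t) (g 0) by
        constructor <;> linarith)
    have h1 := hpos r ⟨hr.1, hr.2.trans ht.2⟩ (by linarith)
    have := hr.2
    linarith

/-- A function that ascends from `0` to `l`, injective and of unit speed where it is positive. -/
lemma eq_max_of_injOn_pos' (hg : ContinuousOn g (Set.Icc 0 L))
    (hnn : ∀ t ∈ Set.Icc 0 L, 0 ≤ g t) (hle : ∀ t ∈ Set.Icc 0 L, g t ≤ l) (hl : 0 < l)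
    (hinj : ∀ s ∈ Set.Icc 0 L, ∀ t ∈ Set.Icc 0 L, 0 < g s → g s = g t → s = t)
    (hspeed : ∀ s t, 0 ≤ s → s ≤ t → t ≤ L → (∀ r ∈ Set.Icc s t, 0 < g r) →
      |g t - g s| = t - s)
    (hL : g L = l) : ∀ t ∈ Set.Icc 0 L, g t = max (l - L + t) 0 := by
  have hm : ∀ t ∈ Set.Icc 0 L, L - t ∈ Set.Icc 0 L := fun t ht =>
    ⟨sub_nonneg.2 ht.2, sub_le_self _ ht.1⟩
  -- Time reversal.
  have key := eq_max_of_injOn_pos (g := fun t => g (L - t)) (L := L) (l := l)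
    (hg.comp (by fun_prop) hm) (fun t ht => hnn _ (hm t ht)) (fun t ht => hle _ (hm t ht)) hl
    (fun s hs t ht h1 h2 => by
      have := hinj _ (hm s hs) _ (hm t ht) h1 h2
      linarith)
    (fun s t h1 h2 h3 h4 => by
      rw [abs_sub_comm, hspeed (L - t) (L - s) (by linarith) (by linarith) (by linarith)]
      · ring
      · intro r hr
        have := h4 (L - r) ⟨by linarith [hr.2], by linarith [hr.1]⟩
        simpa using this)
    (by simpa using hL)
  intro t ht
  have h := key (L - t) (hm t ht)
  simp only [sub_sub_cancel] at h
  rw [h]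
  ring_nf

end Excursion

/-! ### Distance along the edge of a leaf, and its convex increasing functions -/

namespace MetricGraph

variable {V E : Type*} (G : MetricGraph V E)

/-- The distance, on the edge of the end `b`, from the end opposite to `b`. -/
def oppDist (b : E × Bool) (x : ℝ) : ℝ := if b.2 then x else G.len b.1 - x

lemma oppDist_mem (b : E × Bool) {x : ℝ} (hx : x ∈ Set.Icc 0 (G.len b.1)) :
    G.oppDist b x ∈ Set.Icc 0 (G.len b.1) := by
  unfold oppDist
  split_ifs
  · exact hx
  · exact ⟨sub_nonneg.2 hx.2, sub_le_self _ hx.1⟩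

lemma oppDist_oppDist (b : E × Bool) (x : ℝ) : G.oppDist b (G.oppDist b x) = x := by
  unfold oppDist
  split_ifs <;> ring

lemma continuous_oppDist (b : E × Bool) : Continuous (G.oppDist b) := by
  unfold oppDist
  split_ifs <;> fun_prop

lemma oppDist_endCoord (b : E × Bool) : G.oppDist b (G.endCoord b) = G.len b.1 := by
  rcases b with ⟨e, _ | _⟩ <;> simp [oppDist, endCoord]

lemma oppDist_endCoord_opp (b : E × Bool) : G.oppDist b (G.endCoord (b.1, !b.2)) = 0 := by
  rcases b with ⟨e, _ | _⟩ <;> simp [oppDist, endCoord]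

lemma eq_or_eq_opp {a b : E × Bool} (h : a.1 = b.1) : a = b ∨ a = (b.1, !b.2) := by
  rcases a with ⟨e, _ | _⟩ <;> rcases b with ⟨e', _ | _⟩ <;> simp_all

open Classical in
/-- The distance from the edge complement: on the edge of the leaf `b` the distance from the end
opposite to `b`, and zero on the other edges. -/
def leafDist (b : E × Bool) (hb : ∀ a, G.vert a = G.vert b → a = b) : G.Point → ℝ :=
  G.glue (fun e x => if e = b.1 then G.oppDist b x else 0)
    (fun v => if v = G.vert b then G.len b.1 else 0) (by
      intro a
      by_cases hv : G.vert a = G.vert b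
      · obtain rfl := hb a hv
        simp [oppDist_endCoord]
      · simp only [hv, if_false]
        by_cases ha : a.1 = b.1
        · rcases eq_or_eq_opp ha with rfl | rfl
          · exact absurd rfl hv
          · simp [oppDist_endCoord_opp]
        · simp [ha])

variable {G} {b : E × Bool} (hb : ∀ a, G.vert a = G.vert b → a = b)

lemma continuous_leafDist : Continuous (G.leafDist b hb) := by
  refine G.continuous_glue _ _ fun e => ?_
  split_ifs
  · exact G.continuous_oppDist b
  · exact continuous_const

lemma leafDist_pt (x : Set.Icc (0 : ℝ) (G.len b.1)) :
    G.leafDist b hb (G.pt b.1 x) = G.oppDist b x := by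
  simp [leafDist, glue_pt]

lemma leafDist_pt_of_ne {e : E} (he : e ≠ b.1) (x : Set.Icc (0 : ℝ) (G.len e)) :
    G.leafDist b hb (G.pt e x) = 0 := by
  simp [leafDist, glue_pt, he]

lemma leafDist_endPt : G.leafDist b hb (G.endPt b) = G.len b.1 := by
  simp [leafDist, glue_endPt]

lemma leafDist_endPt_of_ne {a : E × Bool} (ha : G.vert a ≠ G.vert b) :
    G.leafDist b hb (G.endPt a) = 0 := by
  simp [leafDist, glue_endPt, ha]

lemma leafDist_mem (p : G.Point) : G.leafDist b hb p ∈ Set.Icc 0 (G.len b.1) := by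
  obtain ⟨e, x, rfl⟩ := G.exists_pt p
  by_cases he : e = b.1
  · subst he
    rw [leafDist_pt]
    exact G.oppDist_mem b x.2
  · rw [leafDist_pt_of_ne hb he]
    exact ⟨le_rfl, G.len_nonneg _⟩

/-- A point at positive distance is determined by this distance. -/
lemma eq_pt_of_leafDist_pos {p : G.Point} (hp : 0 < G.leafDist b hb p) :
    p = G.pt b.1 ⟨G.oppDist b (G.leafDist b hb p), G.oppDist_mem b (leafDist_mem hb p)⟩ := by
  obtain ⟨e, x, rfl⟩ := G.exists_pt p
  by_cases he : e = b.1
  · subst he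
    congr 1
    apply Subtype.ext
    simp only [leafDist_pt, oppDist_oppDist]
  · rw [leafDist_pt_of_ne hb he] at hp
    exact absurd hp (lt_irrefl _)

/-- A convex increasing function of the distance is convex along all paths between leaves. -/
lemma comp_leafDist_mem_convexClass [Fintype E] [DecidableEq V] {Q : ℝ → ℝ} {M : ℝ}
    (hconv : ConvexOn ℝ (Set.Icc 0 (G.len b.1)) Q) (hmono : MonotoneOn Q (Set.Icc 0 (G.len b.1)))
    (hQ : ∀ s ∈ Set.Icc 0 (G.len b.1), 0 ≤ Q s ∧ Q s ≤ M) :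
    (fun p => Q (G.leafDist b hb p)) ∈ G.convexClass M := by
  refine ⟨?_, fun P _ s _ => hQ _ (leafDist_mem hb _)⟩
  rintro P ⟨a, a', -, -, hne, hP0, hPL⟩
  set L := P.length
  set l := G.len b.1
  have hL : 0 < L := P.length_pos
  have hl : 0 < l := G.len_pos b.1
  let g : ℝ → ℝ := fun t => G.leafDist b hb (P.toFun t)
  have hg : ContinuousOn g (Set.Icc 0 L) :=
    (continuous_leafDist hb).comp_continuousOn P.continuousOn
  have hnn : ∀ t ∈ Set.Icc 0 L, 0 ≤ g t := fun t _ => (leafDist_mem hb _).1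
  have hle : ∀ t ∈ Set.Icc 0 L, g t ≤ l := fun t _ => (leafDist_mem hb _).2
  have hinj : ∀ s ∈ Set.Icc 0 L, ∀ t ∈ Set.Icc 0 L, 0 < g s → g s = g t → s = t := by
    intro s hs t ht hpos hst
    refine P.injOn hs ht ?_
    have hpos' : 0 < g t := hst ▸ hpos
    rw [eq_pt_of_leafDist_pos hb hpos, eq_pt_of_leafDist_pos hb hpos']
    congr 2
    exact congrArg _ hst
  have hspeed : ∀ s t, 0 ≤ s → s ≤ t → t ≤ L → (∀ r ∈ Set.Icc s t, 0 < g r) →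
      |g t - g s| = t - s := by
    intro s t h1 h2 h3 h4
    rw [← P.unit_speed s t h1 h2 h3 b.1
      (fun r => ⟨G.oppDist b (g r), G.oppDist_mem b (leafDist_mem hb _)⟩) ?_
      (fun r hr => eq_pt_of_leafDist_pos hb (h4 r hr))]
    · simp only [oppDist]
      split_ifs
      · rfl
      · rw [abs_sub_comm]
        congr 1
        ring
    · exact Topology.IsInducing.subtypeVal.continuousOn_iff.2
        ((G.continuous_oppDist b).comp_continuousOn (hg.mono (Set.Icc_subset_Icc h1 h3)))
  -- A path that starts at b gives a descending ramp, one that ends at b an ascending ramp, and any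
  -- other never enters the interior of this edge.
  have main : ∃ h : ℝ → ℝ, ConvexOn ℝ (Set.Icc 0 L) h ∧ ∀ t ∈ Set.Icc 0 L, g t = h t := by
    by_cases ha : G.vert a = G.vert b
    · refine ⟨fun t => max (l - t) 0, ?_, eq_max_of_injOn_pos hg hnn hle hl hinj hspeed ?_⟩
      · exact (((convexOn_const l (convex_Icc 0 L)).sub (concaveOn_id (convex_Icc 0 L)))).sup
          (convexOn_const 0 (convex_Icc 0 L))
      · change G.leafDist b hb (P.toFun 0) = l
        rw [hP0, hb a ha, leafDist_endPt]
    have h0 : g 0 = 0 := by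
      change G.leafDist b hb (P.toFun 0) = 0
      rw [hP0, leafDist_endPt_of_ne hb ha]
    by_cases ha' : G.vert a' = G.vert b
    · refine ⟨fun t => max (l - L + t) 0, ?_, eq_max_of_injOn_pos' hg hnn hle hl hinj hspeed ?_⟩
      · exact ((convexOn_const (l - L) (convex_Icc 0 L)).add (convexOn_id (convex_Icc 0 L))).sup
          (convexOn_const 0 (convex_Icc 0 L))
      · change G.leafDist b hb (P.toFun L) = l
        rw [hPL, hb a' ha', leafDist_endPt]
    · refine ⟨fun _ => 0, convexOn_const 0 (convex_Icc 0 L),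
        eq_zero_of_injOn_pos hg hnn hinj h0 ?_⟩
      change G.leafDist b hb (P.toFun L) = 0
      rw [hPL, leafDist_endPt_of_ne hb ha']
  obtain ⟨h, hh, hgh⟩ := main
  refine (hconv.comp_of_mapsTo hmono hh fun t ht => ?_).congr fun t ht => ?_
  · rw [← hgh t ht]
    exact leafDist_mem hb _
  · change Q (h t) = Q (g t)
    rw [hgh t ht]

end MetricGraph

/-! ### An explicit convex potential on an interval with explicit ground state -/

namespace LeafProfile

variable (a lam l : ℝ)

/-- The coefficient that makes `slope` vanish at `l`. -/
def coeff : ℝ := (a + (lam + a ^ 2) * l) / l ^ 3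

/-- The logarithmic derivative of the ground state. -/
def slope (s : ℝ) : ℝ := -a - (lam + a ^ 2) * s + coeff a lam l * s ^ 3

def slopeDeriv (s : ℝ) : ℝ := -(lam + a ^ 2) + 3 * coeff a lam l * s ^ 2

/-- The ground state. -/
def state (s : ℝ) : ℝ :=
  Real.exp (-a * s - (lam + a ^ 2) * s ^ 2 / 2 + coeff a lam l * s ^ 4 / 4)

def stateDeriv (s : ℝ) : ℝ := slope a lam l s * state a lam l s

/-- The potential. -/
def potential (s : ℝ) : ℝ := lam + slopeDeriv a lam l s + slope a lam l s ^ 2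

def potentialDeriv (s : ℝ) : ℝ :=
  6 * coeff a lam l * s + 2 * slope a lam l s * slopeDeriv a lam l s

lemma hasDerivAt_slope (s : ℝ) : HasDerivAt (slope a lam l) (slopeDeriv a lam l s) s := by
  have h := (((hasDerivAt_id s).const_mul (lam + a ^ 2)).const_sub (-a)).add
    (((hasDerivAt_id s).fun_pow 3).const_mul (coeff a lam l))
  refine h.congr_deriv ?_
  simp only [slopeDeriv, id]
  ring

lemma hasDerivAt_slopeDeriv (s : ℝ) :
    HasDerivAt (slopeDeriv a lam l) (6 * coeff a lam l * s) s := by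
  have h := (((hasDerivAt_id s).fun_pow 2).const_mul (3 * coeff a lam l)).const_add
    (-(lam + a ^ 2))
  refine h.congr_deriv ?_
  simp only [id]
  ring

lemma hasDerivAt_potential (s : ℝ) :
    HasDerivAt (potential a lam l) (potentialDeriv a lam l s) s := by
  have h := ((hasDerivAt_slopeDeriv a lam l s).const_add lam).add
    ((hasDerivAt_slope a lam l s).fun_pow 2)
  refine h.congr_deriv ?_
  simp only [potentialDeriv]
  ring

lemma hasDerivAt_potentialDeriv (s : ℝ) :
    HasDerivAt (potentialDeriv a lam l) (6 * coeff a lam l * (1 + 2 * s * slope a lam l s)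
      + 2 * slopeDeriv a lam l s ^ 2) s := by
  have h := ((hasDerivAt_id s).const_mul (6 * coeff a lam l)).add
    (((hasDerivAt_slope a lam l s).const_mul 2).fun_mul (hasDerivAt_slopeDeriv a lam l s))
  refine h.congr_deriv ?_
  ring

lemma hasDerivAt_state (s : ℝ) : HasDerivAt (state a lam l) (stateDeriv a lam l s) s := by
  have h := ((((hasDerivAt_id s).const_mul (-a)).fun_sub
    ((((hasDerivAt_id s).fun_pow 2).const_mul (lam + a ^ 2)).div_const 2)).fun_add
    ((((hasDerivAt_id s).fun_pow 4).const_mul (coeff a lam l)).div_const 4)).exp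
  refine h.congr_deriv ?_
  simp only [stateDeriv, slope, state, id]
  ring

/-- Riccati: if ψ' = wψ then ψ'' = (w' + w²)ψ, so the potential is whatever makes ψ an eigenfunction
with eigenvalue `lam`. -/
lemma hasDerivAt_stateDeriv (s : ℝ) :
    HasDerivAt (stateDeriv a lam l) ((potential a lam l s - lam) * state a lam l s) s := by
  refine ((hasDerivAt_slope a lam l s).fun_mul (hasDerivAt_state a lam l s)).congr_deriv ?_
  simp only [stateDeriv, potential]
  ring

lemma state_pos (s : ℝ) : 0 < state a lam l s := Real.exp_pos _

lemma state_zero : state a lam l 0 = 1 := by simp [state]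

lemma stateDeriv_zero : stateDeriv a lam l 0 = -a := by simp [stateDeriv, state, slope]

variable {a lam l}

lemma coeff_mul (hl : 0 < l) : coeff a lam l * l ^ 3 = a + (lam + a ^ 2) * l := by
  unfold coeff
  field_simp

lemma slope_end (hl : 0 < l) : slope a lam l l = 0 := by
  rw [slope, coeff_mul hl]
  ring

lemma stateDeriv_end (hl : 0 < l) : stateDeriv a lam l l = 0 := by
  simp [stateDeriv, slope_end hl]

/-- The linear coefficient -(lam + a²) of `slope` is chosen for this, so that the potential extends
continuously by zero to the other edges. -/
lemma potential_zero : potential a lam l 0 = 0 := by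
  simp [potential, slope, slopeDeriv]

lemma continuous_potential : Continuous (potential a lam l) :=
  continuous_iff_continuousAt.2 fun s => (hasDerivAt_potential a lam l s).continuousAt

section Small

variable (hl : 0 < l) (ha : 0 ≤ a) (hlam : 0 ≤ lam)
  (hsmall : 2 * l * (a + (lam + a ^ 2) * l) ≤ 1)
include hl ha hlam

lemma coeff_nonneg : 0 ≤ coeff a lam l := by
  unfold coeff
  positivity

include hsmall

/-- The second derivative of the potential is 6 coeff (1 + 2 s w) + 2 w'², where w is `slope`; the
smallness assumption is exactly what keeps 1 + 2 s w nonnegative. -/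
lemma potentialDeriv_monotoneOn : MonotoneOn (potentialDeriv a lam l) (Set.Icc 0 l) := by
  refine monotoneOn_of_hasDerivWithinAt_nonneg (convex_Icc 0 l)
    (fun s _ => (hasDerivAt_potentialDeriv a lam l s).continuousAt.continuousWithinAt)
    (fun s _ => (hasDerivAt_potentialDeriv a lam l s).hasDerivWithinAt) fun s hs => ?_
  have hs' := interior_subset hs
  have hc := coeff_nonneg hl ha hlam
  have hslope : -(a + (lam + a ^ 2) * l) ≤ slope a lam l s := by
    have h1 : 0 ≤ coeff a lam l * s ^ 3 := mul_nonneg hc (pow_nonneg hs'.1 3)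
    have h2 : (lam + a ^ 2) * s ≤ (lam + a ^ 2) * l :=
      mul_le_mul_of_nonneg_left hs'.2 (by positivity)
    unfold slope
    linarith
  have h1 : s * -(a + (lam + a ^ 2) * l) ≤ s * slope a lam l s :=
    mul_le_mul_of_nonneg_left hslope hs'.1
  have h2 : s * (a + (lam + a ^ 2) * l) ≤ l * (a + (lam + a ^ 2) * l) :=
    mul_le_mul_of_nonneg_right hs'.2 (by positivity)
  have h3 : 0 ≤ 1 + 2 * s * slope a lam l s := by linarith
  positivity

lemma potential_convexOn : ConvexOn ℝ (Set.Icc 0 l) (potential a lam l) := by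
  have hm := potentialDeriv_monotoneOn hl ha hlam hsmall
  refine MonotoneOn.convexOn_of_deriv (convex_Icc 0 l) continuous_potential.continuousOn
    (fun s _ => (hasDerivAt_potential a lam l s).differentiableAt.differentiableWithinAt) ?_
  intro s hs t ht hst
  rw [(hasDerivAt_potential a lam l s).deriv, (hasDerivAt_potential a lam l t).deriv]
  exact hm (interior_subset hs) (interior_subset ht) hst

/-- The derivative is increasing and starts from 2a(lam + a²) ≥ 0, because `slope` has no quadratic
term. -/
lemma potential_monotoneOn : MonotoneOn (potential a lam l) (Set.Icc 0 l) := by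
  refine monotoneOn_of_hasDerivWithinAt_nonneg (convex_Icc 0 l)
    continuous_potential.continuousOn
    (fun s _ => (hasDerivAt_potential a lam l s).hasDerivWithinAt) fun s hs => ?_
  have hs' := interior_subset hs
  refine le_trans ?_ (potentialDeriv_monotoneOn hl ha hlam hsmall ⟨le_rfl, hl.le⟩ hs' hs'.1)
  simp only [potentialDeriv, slope, slopeDeriv]
  have : 0 ≤ 2 * a * (lam + a ^ 2) := by positivity
  linarith

lemma potential_mem {M : ℝ} (hM : 3 * (a + (lam + a ^ 2) * l) ≤ M * l) :
    ∀ s ∈ Set.Icc 0 l, 0 ≤ potential a lam l s ∧ potential a lam l s ≤ M := by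
  intro s hs
  have hm := potential_monotoneOn hl ha hlam hsmall
  constructor
  · rw [← potential_zero (a := a) (lam := lam) (l := l)]
    exact hm ⟨le_rfl, hl.le⟩ hs hs.1
  · refine (hm hs ⟨hl.le, le_rfl⟩ hs.2).trans ?_
    rw [potential, slope_end hl, slopeDeriv]
    have h1 : 3 * coeff a lam l * l ^ 2 ≤ M := by
      refine le_of_mul_le_mul_right ?_ hl
      calc 3 * coeff a lam l * l ^ 2 * l = 3 * (coeff a lam l * l ^ 3) := by ring
        _ ≤ M * l := by rw [coeff_mul hl]; exact hM
    nlinarith [sq_nonneg a]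

end Small

end LeafProfile

/-! ### Solutions of the Helmholtz equation on an interval -/

section Wave

/-- The solution of `-f'' = k² f` with initial value `A` and initial derivative `B`. -/
def wave (k A B t : ℝ) : ℝ := A * Real.cos (k * t) + B * (Real.sin (k * t) / k)

def waveDeriv (k A B t : ℝ) : ℝ := -k * A * Real.sin (k * t) + B * Real.cos (k * t)

variable {k A B l t : ℝ}

lemma hasDerivAt_wave (hk : k ≠ 0) : HasDerivAt (wave k A B) (waveDeriv k A B t) t := by
  have h1 : HasDerivAt (fun t => k * t) k t := by simpa using (hasDerivAt_id t).const_mul k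
  refine ((h1.cos.const_mul A).fun_add ((h1.sin.div_const k).const_mul B)).congr_deriv ?_
  simp only [waveDeriv]
  field_simp

lemma hasDerivAt_waveDeriv (hk : k ≠ 0) :
    HasDerivAt (waveDeriv k A B) (-k ^ 2 * wave k A B t) t := by
  have h1 : HasDerivAt (fun t => k * t) k t := by simpa using (hasDerivAt_id t).const_mul k
  refine ((h1.sin.const_mul (-k * A)).fun_add (h1.cos.const_mul B)).congr_deriv ?_
  simp only [wave]
  field_simp
  ring

lemma wave_zero : wave k A B 0 = A := by simp [wave]

lemma waveDeriv_zero : waveDeriv k A B 0 = B := by simp [waveDeriv]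

lemma mul_sinc (hk : k ≠ 0) (hl : l ≠ 0) : l * Real.sinc (k * l) = Real.sin (k * l) / k := by
  rw [Real.sinc_of_ne_zero (mul_ne_zero hk hl)]
  field_simp

lemma wave_end (hk : k ≠ 0) (hl : l ≠ 0) (hs : Real.sin (k * l) ≠ 0) (A' : ℝ) :
    wave k A ((A' - Real.cos (k * l) * A) / (l * Real.sinc (k * l))) l = A' := by
  rw [mul_sinc hk hl, wave]
  field_simp
  ring

lemma waveDeriv_end (hk : k ≠ 0) (hl : l ≠ 0) (hs : Real.sin (k * l) ≠ 0) (A' : ℝ) :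
    waveDeriv k A ((A' - Real.cos (k * l) * A) / (l * Real.sinc (k * l))) l =
      -((A - Real.cos (k * l) * A') / (l * Real.sinc (k * l))) := by
  rw [mul_sinc hk hl, waveDeriv]
  field_simp
  linear_combination (-A) * Real.sin_sq_add_cos_sq (k * l)

/-- For k t ≤ 1 the cosine is at least 1/2, so the cosine term is at least 1/4, while |sin(k t)/k| ≤
l keeps the sine term below 1/8. -/
lemma wave_pos (hk : 0 < k) (hkl : k * l ≤ 1) (hA : 1 / 2 < A) (hB : |B| * l < 1 / 8)
    (ht : t ∈ Set.Icc 0 l) : 0 < wave k A B t := by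
  have hkt0 : 0 ≤ k * t := mul_nonneg hk.le ht.1
  have hkt : k * t ≤ 1 := (mul_le_mul_of_nonneg_left ht.2 hk.le).trans hkl
  have hcos : 1 / 2 ≤ Real.cos (k * t) := by
    have := Real.one_sub_sq_div_two_le_cos (x := k * t)
    nlinarith
  have hsin : |Real.sin (k * t) / k| ≤ l := by
    rw [abs_div, abs_of_pos hk, div_le_iff₀ hk]
    calc |Real.sin (k * t)| ≤ |k * t| := Real.abs_sin_le_abs
      _ = k * t := abs_of_nonneg hkt0
      _ ≤ l * k := by rw [mul_comm]; exact mul_le_mul_of_nonneg_right ht.2 hk.le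
  have h1 : |B * (Real.sin (k * t) / k)| < 1 / 8 := by
    rw [abs_mul]
    exact (mul_le_mul_of_nonneg_left hsin (abs_nonneg B)).trans_lt hB
  have h2 := (abs_lt.1 h1).1
  have h3 : 1 / 2 * (1 / 2) ≤ A * Real.cos (k * t) := by gcongr
  unfold wave
  linarith

end Wave

namespace MetricGraph

variable {V E : Type*} {G : MetricGraph V E} {b : E × Bool}

/-! ### The perturbed ground state -/

lemma vert_opp_ne (hb : ∀ a, G.vert a = G.vert b → a = b) : G.vert (b.1, !b.2) ≠ G.vert b := by
  intro h
  have := congrArg Prod.snd (hb _ h)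
  simp at this

lemma vert_ne_of_edge_ne (hb : ∀ a, G.vert a = G.vert b → a = b) {a : E × Bool} (ha : a.1 ≠ b.1) :
    G.vert a ≠ G.vert b := fun h => ha (by rw [hb a h])

open Classical in
/-- The outward derivatives of the Helmholtz solution, on the edges other than that of `b`. -/
def restDeriv (G : MetricGraph V E) (b : E × Bool) (k : ℝ) (x : V → ℝ) (a : E × Bool) : ℝ :=
  if a.1 = b.1 then 0 else G.outDeriv k x a

variable [Fintype E] [DecidableEq V]

/-- The total outward derivative at the vertex opposite to `b`. -/
def restFlux (G : MetricGraph V E) (b : E × Bool) (k : ℝ) (x : V → ℝ) : ℝ :=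
  ∑ a : E × Bool with G.vert a = G.vert (b.1, !b.2), G.restDeriv b k x a

lemma continuousAt_restFlux {x : ℝ → V → ℝ} (hx : ContinuousAt x 0) :
    ContinuousAt (fun k => G.restFlux b k (x k)) 0 := by
  refine tendsto_finsetSum _ fun a _ => ?_
  simp only [restDeriv]
  split_ifs
  · exact tendsto_const_nhds
  · exact G.continuousAt_outDeriv hx a

lemma restFlux_zero_one : G.restFlux b 0 1 = 0 :=
  Finset.sum_eq_zero fun a _ => by simp [restDeriv, outDeriv_zero]

/-- At the leaf only the discarded edge is incident; at the remaining vertices that edge is absent,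
so nothing is lost by discarding it. -/
lemma sum_restDeriv (hb : ∀ a, G.vert a = G.vert b → a = b) {k : ℝ} {x : V → ℝ}
    (hx : ∀ v, v ≠ G.vert (b.1, !b.2) → v ≠ G.vert b →
      ∑ a : E × Bool with G.vert a = v, G.outDeriv k x a = 0) {v : V}
    (hv : v ≠ G.vert (b.1, !b.2)) :
    ∑ a : E × Bool with G.vert a = v, G.restDeriv b k x a = 0 := by
  by_cases hvb : v = G.vert b
  · refine Finset.sum_eq_zero fun a ha => ?_
    rw [hb a ((Finset.mem_filter.1 ha).2.trans hvb)]
    simp [restDeriv]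
  · rw [← hx v hv hvb]
    refine Finset.sum_congr rfl fun a ha => ?_
    have hav := (Finset.mem_filter.1 ha).2
    rw [restDeriv, if_neg]
    intro hab
    rcases eq_or_eq_opp hab with rfl | rfl
    · exact hvb hav.symm
    · exact hv hav.symm

/-- The flux at the opposite vertex equals the sum over all ends, as the other vertices contribute
zero. Each retained edge contributes (x + x')(1 - cos)/(l sinc) ≥ 0: a nonnegative solution of -f''
= k²f is concave. -/
lemma restFlux_nonneg (hb : ∀ a, G.vert a = G.vert b → a = b) {k : ℝ} {x : V → ℝ}
    (hx : ∀ v, v ≠ G.vert (b.1, !b.2) → v ≠ G.vert b →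
      ∑ a : E × Bool with G.vert a = v, G.outDeriv k x a = 0)
    (hpos : ∀ v, 0 ≤ x v) (hsinc : ∀ e, 0 ≤ Real.sinc (k * G.len e)) :
    0 ≤ G.restFlux b k x := by
  have := G.finite_vertices
  have := Fintype.ofFinite V
  have h : G.restFlux b k x = ∑ a, G.restDeriv b k x a := by
    rw [← Finset.sum_fiberwise Finset.univ G.vert]
    exact (Finset.sum_eq_single _ (fun v _ hv => sum_restDeriv hb hx hv) (by simp)).symm
  rw [h, sum_ends_eq]
  refine Finset.sum_nonneg fun e _ => ?_
  simp only [restDeriv]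
  split_ifs
  · simp
  · simp only [outDeriv, Bool.not_false, Bool.not_true]
    rw [← add_div]
    refine div_nonneg ?_ (mul_nonneg (G.len_nonneg e) (hsinc e))
    have h1 := mul_nonneg (add_nonneg (hpos (G.vert (e, false))) (hpos (G.vert (e, true))))
      (sub_nonneg.2 (Real.cos_le_one (k * G.len e)))
    linarith

open LeafProfile in
/-- The glued function is a positive eigenfunction. -/
lemma exists_pos_mem_eigenspace (hb : ∀ a, G.vert a = G.vert b → a = b) {k : ℝ} {x : V → ℝ}
    (hk : 0 < k) (hkl : ∀ e, k * G.len e ≤ 1) (hx0 : x (G.vert (b.1, !b.2)) = 1)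
    (hx : ∀ v, v ≠ G.vert (b.1, !b.2) → v ≠ G.vert b →
      ∑ a : E × Bool with G.vert a = v, G.outDeriv k x a = 0)
    (hxpos : ∀ v, 1 / 2 < x v) (hder : ∀ a, |G.outDeriv k x a| * G.len a.1 < 1 / 8) :
    ∃ phi ∈ G.eigenspace (fun p => potential (G.restFlux b k x) (k ^ 2) (G.len b.1)
      (G.leafDist b hb p)) (k ^ 2), ∀ p, 0 < phi p := by
  classical
  have hk0 := hk.ne'
  have hl0 : ∀ e, G.len e ≠ 0 := fun e => (G.len_pos e).ne'
  have hs : ∀ e, Real.sin (k * G.len e) ≠ 0 := fun e =>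
    (Real.sin_pos_of_pos_of_lt_pi (mul_pos hk (G.len_pos e))
      ((hkl e).trans_lt (by linarith [Real.pi_gt_three]))).ne'
  set c := G.restFlux b k x
  set l := G.len b.1
  have hl : 0 < l := G.len_pos b.1
  -- Orientation of the edge relative to the distance from `v₀`; it squares to one and so drops out
  -- of the second-order equation.
  let sgn : ℝ := if b.2 then 1 else -1
  have hsgn : sgn * sgn = 1 := by
    simp only [sgn]
    split_ifs <;> norm_num
  let f : E → ℝ → ℝ := fun e t => if e = b.1 then state c (k ^ 2) l (G.oppDist b t) else
    wave k (x (G.vert (e, false))) (G.outDeriv k x (e, false)) t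
  let d : E → ℝ → ℝ := fun e t => if e = b.1 then stateDeriv c (k ^ 2) l (G.oppDist b t) * sgn else
    waveDeriv k (x (G.vert (e, false))) (G.outDeriv k x (e, false)) t
  let X : V → ℝ := fun v => if v = G.vert b then state c (k ^ 2) l l else x v
  have hopp : ∀ t, HasDerivAt (G.oppDist b) sgn t := by
    intro t
    unfold oppDist
    simp only [sgn]
    split_ifs
    · exact hasDerivAt_id t
    · exact (hasDerivAt_id t).const_sub _
  have hfX : ∀ a : E × Bool, f a.1 (G.endCoord a) = X (G.vert a) := by
    intro a
    by_cases ha : a.1 = b.1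
    · rcases eq_or_eq_opp ha with rfl | rfl
      · simp [f, X, oppDist_endCoord, l]
      · simp only [f, X, oppDist_endCoord_opp, vert_opp_ne hb, if_true, if_false, state_zero, hx0]
    · have hv := vert_ne_of_edge_ne hb ha
      simp only [f, X, ha, hv, if_false]
      obtain ⟨e, _ | _⟩ := a
      · simp [endCoord, wave_zero]
      · simpa [endCoord, outDeriv] using wave_end hk0 (hl0 e) (hs e) (x (G.vert (e, true)))
  have hf : ∀ e t, HasDerivAt (f e) (d e t) t := by
    intro e t
    by_cases he : e = b.1
    · simp only [f, d, he, if_true]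
      exact (hasDerivAt_state c (k ^ 2) l (G.oppDist b t)).comp t (hopp t)
    · simp only [f, d, he, if_false]
      exact hasDerivAt_wave hk0
  have hd : ∀ e, ∀ t ∈ Set.Icc 0 (G.len e), HasDerivAt (d e)
      ((G.onEdge (fun p => potential c (k ^ 2) l (G.leafDist b hb p)) e t - k ^ 2) * f e t) t := by
    intro e t ht
    rw [onEdge_of_mem _ _ _ ht]
    by_cases he : e = b.1
    · subst he
      simp only [f, d, if_true, leafDist_pt]
      refine (((hasDerivAt_stateDeriv c (k ^ 2) l (G.oppDist b t)).comp t
        (hopp t)).mul_const sgn).congr_deriv ?_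
      rw [mul_assoc, hsgn, mul_one]
    · simp only [f, d, he, if_false, leafDist_pt_of_ne hb he, potential_zero]
      exact (hasDerivAt_waveDeriv hk0).congr_deriv (by ring)
  -- The profile has zero derivative at b and sends c into the opposite vertex, where it balances
  -- the flux c leaving into the rest of the tree.
  have hnormal : ∀ a, G.normalDeriv d a =
      (if a = (b.1, !b.2) then c else 0) - G.restDeriv b k x a := by
    intro a
    by_cases ha : a.1 = b.1
    · rcases eq_or_eq_opp ha with rfl | rfl
      · have h1 : a ≠ (a.1, !a.2) := by
          intro h
          have := congrArg Prod.snd h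
          simp at this
        rw [if_neg h1]
        obtain ⟨e, _ | _⟩ := a <;>
          simp [normalDeriv, d, restDeriv, sgn, oppDist, l, stateDeriv_end hl]
      · obtain ⟨e, _ | _⟩ := b <;>
          simp [normalDeriv, d, restDeriv, sgn, oppDist, l, stateDeriv_zero]
    · have h1 : a ≠ (b.1, !b.2) := fun h => ha (by rw [h])
      rw [if_neg h1, restDeriv, if_neg ha]
      obtain ⟨e, _ | _⟩ := a
      · simp only at ha
        simp [normalDeriv, d, ha, waveDeriv_zero]
      · simp only at ha
        simpa [normalDeriv, d, ha, outDeriv] using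
          waveDeriv_end hk0 (hl0 e) (hs e) (x (G.vert (e, true)))
  have hkir : ∀ v, ∑ a : E × Bool with G.vert a = v, G.normalDeriv d a = 0 := by
    intro v
    rw [Finset.sum_congr rfl fun a _ => hnormal a, Finset.sum_sub_distrib, Finset.sum_ite_eq']
    by_cases hv : v = G.vert (b.1, !b.2)
    · subst hv
      simp [c, restFlux]
    · rw [sum_restDeriv hb hx hv]
      simp [Ne.symm hv]
  refine ⟨G.glue f X hfX, (isClassicalSolution_glue hfX hf hd hkir).mem_eigenspace
    (continuous_potential.comp (continuous_leafDist hb)), fun p => ?_⟩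
  obtain ⟨e, t, rfl⟩ := G.exists_pt p
  rw [glue_pt]
  by_cases he : e = b.1
  · simp only [f, he, if_true]
    exact state_pos _ _ _ _
  · simp only [f, he, if_false]
    exact wave_pos hk (hkl e) (hxpos _) (hder (e, false)) t.2

/-- There are arbitrarily small convex potentials, supported on the edge of a leaf, whose lowest
eigenvalue is positive and has a positive eigenfunction. -/
lemma exists_potential (hG : G.IsTree) (hb : ∀ a, G.vert a = G.vert b → a = b) {M : ℝ}
    (hM : 0 < M) :
    ∃ Q : ℝ → ℝ, Continuous Q ∧ Q 0 = 0 ∧ (fun p => Q (G.leafDist b hb p)) ∈ G.convexClass M ∧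
      ∃ lam > 0, ∃ phi ∈ G.eigenspace (fun p => Q (G.leafDist b hb p)) lam, ∀ p, 0 < phi p := by
  have := G.finite_vertices
  obtain ⟨x, hxc, hx0, hx⟩ :=
    G.exists_vertexValues hG.isTree.connected (G.vert (b.1, !b.2)) (G.vert b)
  set l := G.len b.1
  have hl : 0 < l := G.len_pos b.1
  have hflux : ContinuousAt (fun k => G.restFlux b k (x k)) 0 := continuousAt_restFlux hxc
  -- This quantity is l³ times the coefficient of the profile. It tends to 0 with k, which yields
  -- both the convexity condition and the bound by M.
  have hm : ContinuousAt (fun k => G.restFlux b k (x k) +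
      (k ^ 2 + G.restFlux b k (x k) ^ 2) * l) 0 :=
    hflux.add (((continuousAt_id.pow 2).add (hflux.pow 2)).mul continuousAt_const)
  have hm0 : G.restFlux b 0 (x 0) + (0 ^ 2 + G.restFlux b 0 (x 0) ^ 2) * l = 0 := by
    rw [hx0, restFlux_zero_one]
    ring
  have e1 : ∀ᶠ k in nhds (0 : ℝ), 2 * l * (G.restFlux b k (x k) +
      (k ^ 2 + G.restFlux b k (x k) ^ 2) * l) < 1 := by
    refine (continuousAt_const.fun_mul hm).eventually_lt continuousAt_const ?_
    rw [hm0]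
    norm_num
  have e2 : ∀ᶠ k in nhds (0 : ℝ), 3 * (G.restFlux b k (x k) +
      (k ^ 2 + G.restFlux b k (x k) ^ 2) * l) < M * l := by
    refine (continuousAt_const.fun_mul hm).eventually_lt continuousAt_const ?_
    rw [hm0, mul_zero]
    exact mul_pos hM hl
  have e3 : ∀ᶠ k in nhds (0 : ℝ), ∀ v, 1 / 2 < x k v := by
    refine Filter.eventually_all.2 fun v => ?_
    refine continuousAt_const.eventually_lt (continuousAt_pi.1 hxc v) ?_
    rw [hx0]
    norm_num
  have e4 : ∀ᶠ k in nhds (0 : ℝ), ∀ a, |G.outDeriv k (x k) a| * G.len a.1 < 1 / 8 := by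
    refine Filter.eventually_all.2 fun a => ?_
    refine ((G.continuousAt_outDeriv hxc a).abs.fun_mul continuousAt_const).eventually_lt
      continuousAt_const ?_
    rw [hx0, outDeriv_zero]
    norm_num
  have e5 : ∀ᶠ k in nhds (0 : ℝ), ∀ e, k * G.len e < 1 := by
    refine Filter.eventually_all.2 fun e => ?_
    refine (continuousAt_id.mul continuousAt_const).eventually_lt continuousAt_const ?_
    simp
  have hall := (hx.and (e1.and (e2.and (e3.and (e4.and e5))))).filter_mono
    (nhdsWithin_le_nhds (s := Set.Ioi 0))
  obtain ⟨k, ⟨⟨h1, h2⟩, h3, h4, h5, h6, h7⟩, hk⟩ := (hall.and self_mem_nhdsWithin).exists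
  have hk : 0 < k := hk
  have hsinc : ∀ e, 0 ≤ Real.sinc (k * G.len e) := by
    intro e
    have hp := mul_pos hk (G.len_pos e)
    rw [Real.sinc_of_ne_zero hp.ne']
    exact div_nonneg (Real.sin_nonneg_of_nonneg_of_le_pi hp.le
      ((h7 e).le.trans (by linarith [Real.pi_gt_three]))) hp.le
  have hc := restFlux_nonneg hb h2 (fun v => by linarith [h5 v]) hsinc
  have hlam : 0 ≤ k ^ 2 := sq_nonneg k
  exact ⟨_, LeafProfile.continuous_potential, LeafProfile.potential_zero,
    comp_leafDist_mem_convexClass hb (LeafProfile.potential_convexOn hl hc hlam h3.le)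
      (LeafProfile.potential_monotoneOn hl hc hlam h3.le)
      (LeafProfile.potential_mem hl hc hlam h3.le h4.le), k ^ 2, by positivity,
    exists_pos_mem_eigenspace hb hk (fun e => (h7 e).le) h1 h2 h5 h6⟩

/-! ### The fundamental gap -/

/-- A leaf of the adjacency graph has a single neighbour; since parallel edges and loops are
excluded, it also carries a single edge end. -/
lemma IsTree.exists_leaf (hG : G.IsTree) :
    ∃ b : E × Bool, ∀ a, G.vert a = G.vert b → a = b := by
  classical
  have := G.finite_vertices
  have := Fintype.ofFinite V
  obtain ⟨v⟩ := hG.isTree.connected.nonempty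
  obtain ⟨⟨e, -⟩, -⟩ := G.vert_surjective v
  have : Nontrivial V := ⟨_, _, hG.loopless e⟩
  obtain ⟨w, hw⟩ := hG.isTree.exists_vert_degree_one_of_nontrivial
  obtain ⟨z, -, hz⟩ := (SimpleGraph.degree_eq_one_iff_existsUnique_adj).1 hw
  have hends : ∀ a : E × Bool, G.edgeEnds a.1 = s(G.vert a, G.vert (a.1, !a.2)) := by
    rintro ⟨e, _ | _⟩
    · rfl
    · exact Sym2.eq_swap
  have hne : ∀ a : E × Bool, G.vert a ≠ G.vert (a.1, !a.2) := by
    rintro ⟨e, _ | _⟩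
    · exact hG.loopless e
    · exact (hG.loopless e).symm
  have hopp : ∀ a, G.vert a = w → G.vert (a.1, !a.2) = z := by
    rintro a rfl
    exact hz _ ((SimpleGraph.fromEdgeSet_adj _).2 ⟨⟨a.1, hends a⟩, hne a⟩)
  obtain ⟨b, hb⟩ := G.vert_surjective w
  refine ⟨b, fun a hab => ?_⟩
  have ha : G.vert a = w := hab.trans hb
  have he : a.1 = b.1 := hG.no_parallel (by rw [hends, hends, ha, hb, hopp a ha, hopp b hb])
  rcases eq_or_eq_opp he with h | h
  · exact h
  · exact absurd (hab.symm.trans (congrArg G.vert h)) (hne b)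

lemma one_mem_eigenspace : (1 : G.Point → ℝ) ∈ G.eigenspace 0 0 := by
  refine IsClassicalSolution.mem_eigenspace (d := fun _ _ => 0) continuous_const
    ⟨continuous_const, fun e x _ => ?_, fun e x _ => ?_, fun v => ?_⟩
  · exact hasDerivWithinAt_const x _ (1 : ℝ)
  · refine (hasDerivWithinAt_const x _ (0 : ℝ)).congr_deriv ?_
    simp [onEdge, Set.IccExtend]
  · refine Finset.sum_eq_zero ?_
    rintro ⟨e, _ | _⟩ _ <;> simp [normalDeriv]

/-- Evaluation at p is a linear functional, which cannot be injective on a space of dimension at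
least two. -/
lemma exists_eigenfunction_eq_zero {q : G.Point → ℝ} {mu : ℝ} (h : 2 ≤ G.multiplicity q mu)
    (p : G.Point) : ∃ u ∈ G.eigenspace q mu, u ≠ 0 ∧ u p = 0 := by
  by_contra! hne
  let T : G.eigenspace q mu →ₗ[ℝ] ℝ := (LinearMap.proj p).comp (G.eigenspace q mu).subtype
  have hT : Function.Injective T := by
    refine (injective_iff_map_eq_zero T).2 fun u hu => ?_
    by_contra hu0
    exact hne u u.2 (fun h => hu0 (Subtype.ext h)) hu
  have hle := LinearMap.lift_rank_le_of_injective T hT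
  rw [Module.rank_self, Cardinal.lift_one, Cardinal.lift_le_one_iff] at hle
  have := h.trans hle
  norm_num at this

lemma mem_eigenspace_of_support {u q : G.Point → ℝ} {mu : ℝ} (hq : Continuous q)
    (hu : u ∈ G.eigenspace 0 mu) (hqu : ∀ p, q p * u p = 0) : u ∈ G.eigenspace q mu := by
  obtain ⟨d, hd⟩ := exists_isClassicalSolution continuous_zero hu
  refine IsClassicalSolution.mem_eigenspace hq
    ⟨hd.continuous, hd.hasDeriv, fun e x hx => ?_, hd.kirchhoff⟩
  refine (hd.hasDeriv_deriv e x hx).congr_deriv ?_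
  have h1 : G.onEdge q e x * G.onEdge u e x = 0 := hqu _
  have h2 : G.onEdge (0 : G.Point → ℝ) e x = 0 := rfl
  rw [h2]
  linear_combination -h1

end MetricGraph
end

open MetricGraph in
theorem mainTheorem7 {V E : Type*} [Fintype E] [DecidableEq V] (G : MetricGraph V E)
    (hG : G.IsTree) (hmult : 2 ≤ G.multiplicity 0 (G.eigenvalue 0 2)) (M : ℝ) (hM : 0 < M) :
    ¬ IsMinOn G.fundamentalGap (G.convexClass M) 0 := by
  obtain ⟨b, hb⟩ := hG.exists_leaf
  have : Nonempty G.Point := ⟨G.endPt b⟩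
  obtain ⟨Q, hQc, hQ0, hQ, lam, hlam, phi, hphi, hpos⟩ := exists_potential hG hb hM
  have hq := hQc.comp (continuous_leafDist hb)
  obtain ⟨u, hu, hu0, hub⟩ := exists_eigenfunction_eq_zero hmult (G.endPt b)
  have hmu : 0 ≤ G.eigenvalue 0 2 :=
    le_of_eigenspace_ne_bot continuous_zero one_mem_eigenspace (fun _ => one_pos) hu hu0
  obtain ⟨d, hd⟩ := exists_isClassicalSolution continuous_zero hu
  have hedge := onEdge_eq_zero_of_leaf hmu hd hb hub
  have hu' : u ∈ G.eigenspace (fun p => Q (G.leafDist b hb p)) (G.eigenvalue 0 2) := by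
    refine mem_eigenspace_of_support hq hu fun p => ?_
    obtain ⟨e, x, rfl⟩ := G.exists_pt p
    by_cases he : e = b.1
    · subst he
      rw [← G.onEdge_of_mem u b.1 x.2, hedge x x.2, mul_zero]
    · rw [leafDist_pt_of_ne hb he, hQ0, zero_mul]
  -- The values at the leaf separate the two: `phi` is positive there and `u` is zero.
  have hli : LinearIndependent ℝ ![phi, u] := by
    refine LinearIndependent.pair_iff.2 fun s t hst => ?_
    have hs : s = 0 := by
      have h := congrFun hst (G.endPt b)
      simpa [hub, (hpos (G.endPt b)).ne'] using h
    refine ⟨hs, ?_⟩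
    simpa [hs, hu0] using hst
  have h1 : G.eigenvalue (fun p => Q (G.leafDist b hb p)) 1 = lam := eigenvalue_one_eq hq hphi hpos
  have h2 : G.eigenvalue (fun p => Q (G.leafDist b hb p)) 2 ≤ G.eigenvalue 0 2 :=
    eigenvalue_two_le hq hphi hpos hu' hli
  have h3 : G.eigenvalue 0 1 = 0 :=
    eigenvalue_one_eq continuous_zero one_mem_eigenspace fun _ => one_pos
  intro hmin
  -- Minimality would give λ₂(G, 0) ≤ λ₂(G, q) - lam ≤ λ₂(G, 0) - lam, contradicting lam > 0.
  have h4 : G.fundamentalGap 0 ≤ G.fundamentalGap (fun p => Q (G.leafDist b hb p)) := hmin hQ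
  simp only [fundamentalGap, h1, h3] at h4
  linarith
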